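/- **Conventions.** All Hilbert spaces are finite-dimensional and complex. *Linear binary constraint systems.* A linear binary constraint system $\mathcal F$ consists of variables $x_1,\dots,x_m$ with values in $\{+1,-1\}$ and of constraints $C_1,\dots,C_p$, where $C_l$ is an equation $\prod_{x_i\in S_l}x_i=b_l$ with $S_l\subseteq\{x_1,\dots,x_m\}$ and $b_l\in\{+1,-1\}$; we assume that every variable occurs in at least one constraint. Its homogenisation $\mathcal F_0$ is obtained by replacing every $b_l$ by $+1$. The graph $\Gamma^{\mathcal F}$ has as vertices the pairs $(C_l,f)$ with $f:S_l\to\{+1,-1\}$ such that $\prod_{x\in S_l}f(x)=b_l$; the vertices $(C_l,f)$ and $(C_k,g)$ are adjacent if and only if $f(x)\neq g(x)$ for some $x\in S_l\cap S_k$. A quantum solution of $\mathcal F$ on a Hilbert space $H$ is a family $X_1,\dots,X_m$ of self-adjoint operators on $H$ with eigenvalues in $\{+1,-1\}$ such that, for every $l$, the operators $X_i$ with $x_i\in S_l$ commute pairwise and have product $b_l\mathbb 1_H$. *Groups of central type.* A group of central type $(L,\psi)$ is a finite group $L$ with a $2$-cocycle $\psi:L\times L\to U(1)$ whose twisted group algebra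 $\mathbb CL^\psi$ is simple. A nice unitary error basis for $(L,\psi)$ on a Hilbert space $K$ is a family of unitary operators $\{U_a\}_{a\in L}$ on $K$ with $|L|=(\dim K)^2$, $\operatorname{Tr}(U_a^\dagger U_b)=\delta_{a,b}\dim K$ and $U_aU_b=\psi(a,b)U_{ab}$. *Quantum graphs.* A quantum graph is a special symmetric dagger Frobenius algebra $A$ (an algebra on a Hilbert space with multiplication $m$ and unit $u$ that satisfies the Frobenius equations together with $m^\dagger,u^\dagger$, with $mm^\dagger=\mathrm{id}$, and with $u^\dagger m$ a symmetric form) together with a linear map $G=G^\dagger:A\to A$ such that $m(G\otimes G)m^\dagger=G$, $m(G\otimes\mathrm{id})m^\dagger=\mathrm{id}$, and $G$ equals its transpose with respect to $u^\dagger m$. Isomorphisms of quantum graphs are unitary $*$-homomorphisms that intertwine the maps $G$. A finite simple graph $\Gamma$ is regarded as the quantum graph $\mathbb C^{V_\Gamma}$ with pointwise multiplication, where $G$ is the adjacency matrix of $\Gamma$ with all diagonal entries set to $1$. *The quantum graph $\Gamma_{L,\psi}$.* Let $(L,\psi)$ be of central type, let $L\hookrightarrow\operatorname{Aut}(\Gamma)$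 be an embedding, and let $\{U_a\}$ be a nice unitary error basis for $(L,\psi)$ on $K$, $n=\dim K$. Bending wires in $\frac1n\cdot\frac1{\sqrt{|L|}}\sum_{a\in L}|U_a\rangle\langle U_a|\otimes a$ gives the dagger idempotent $$(eF)(w)=\frac1{|L|}\sum_{a\in L}U_a\,F(a^{-1}(w))\,U_a^\dagger$$ on $K^*\otimes\mathbb C^{V_\Gamma}\otimes K$, that is, on the functions $F:V_\Gamma\to\operatorname{End}(K)$ with the inner product $\langle F,F'\rangle=\sum_v\operatorname{Tr}(F(v)^\dagger F'(v))$. The quantum graph $\Gamma_{L,\psi}$ is the image of $e$ (the functions with $F(a(v))=U_aF(v)U_a^\dagger$ for all $a$, $v$), with multiplication $(F,F')\mapsto\sqrt n\,FF'$ (pointwise product), unit $\frac1{\sqrt n}\mathbb 1_K$ (constant function), and quantum adjacency matrix $F\mapsto\big(v\mapsto\sum_{w=v\text{ or }w\sim v}F(w)\big)$. **Proposition.** Let $\mathcal F$ be a linear binary constraint system and let $\{X_i\in\operatorname{End}(H)\}_{1\le i\le m}$ be a quantum solution of $\mathcal F$ such that 1. if $A\in\operatorname{End}(H)$ satisfies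 $AX_i=X_iA$ for all $1\le i\le m$, then $A$ is a scalar multiple of $\mathbb 1_H$; 2. there are a group of central type $(L,\psi)$ and a nice unitary error basis $\{U_a\}_{a\in L}$ for $(L,\psi)$ on $H$ such that, for all $a\in L$ and $1\le i\le m$, $U_a^\dagger X_iU_a=p_i^aX_i$ with $p_i^a\in\{+1,-1\}$. Then there is an embedding $L\hookrightarrow\operatorname{Aut}(\Gamma^{\mathcal F_0})$ such that, for the quantum graph $\Gamma^{\mathcal F_0}_{L,\psi}$ formed along this embedding, with any nice unitary error basis for $(L,\psi)$, the (quantum) graphs $\Gamma^{\mathcal F}$ and $\Gamma^{\mathcal F_0}_{L,\psi}$ are isomorphic. -/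

import Mathlib

universe u

set_option linter.unusedSectionVars false

open scoped TensorProduct

/-! ### Quantum graphs -/

/-- A special symmetric dagger Frobenius algebra: a monoid in finite-dimensional Hilbert spaces
which, together with the comonoid given by the adjoints of its multiplication and unit, satisfies
the Frobenius equations, is special and is symmetric. -/
structure FrobAlg where
  carrier : Type*
  [normed : NormedAddCommGroup carrier]
  [innerProduct : InnerProductSpace ℂ carrier]
  [finite : FiniteDimensional ℂ carrier]
  mul : carrier ⊗[ℂ] carrier →ₗ[ℂ] carrier
  unit : ℂ →ₗ[ℂ] carrier
  mul_assoc : mul ∘ₗ mul.rTensor carrier =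
    mul ∘ₗ mul.lTensor carrier ∘ₗ (TensorProduct.assoc ℂ carrier carrier carrier).toLinearMap
  unit_mul : mul ∘ₗ unit.rTensor carrier = (TensorProduct.lid ℂ carrier).toLinearMap
  mul_unit : mul ∘ₗ unit.lTensor carrier = (TensorProduct.rid ℂ carrier).toLinearMap
  frobenius_left :
    mul.rTensor carrier ∘ₗ (TensorProduct.assoc ℂ carrier carrier carrier).symm.toLinearMap ∘ₗ
      (LinearMap.adjoint mul).lTensor carrier = LinearMap.adjoint mul ∘ₗ mul
  frobenius_right :
    mul.lTensor carrier ∘ₗ (TensorProduct.assoc ℂ carrier carrier carrier).toLinearMap ∘ₗ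
      (LinearMap.adjoint mul).rTensor carrier = LinearMap.adjoint mul ∘ₗ mul
  special : mul ∘ₗ LinearMap.adjoint mul = LinearMap.id
  symmetric : LinearMap.adjoint unit ∘ₗ mul ∘ₗ (TensorProduct.comm ℂ carrier carrier).toLinearMap =
    LinearMap.adjoint unit ∘ₗ mul

namespace FrobAlg

attribute [instance] normed innerProduct finite

/-- The comultiplication, adjoint to the multiplication. -/
noncomputable def comul (A : FrobAlg) : A.carrier →ₗ[ℂ] A.carrier ⊗[ℂ] A.carrier :=
  LinearMap.adjoint A.mul

/-- The counit, adjoint to the unit. -/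
noncomputable def counit (A : FrobAlg) : A.carrier →ₗ[ℂ] ℂ :=
  LinearMap.adjoint A.unit

/-- The canonical involution `a ↦ (id ⊗ ⟨a|) (comul (unit 1))`. -/
noncomputable def star (A : FrobAlg) (a : A.carrier) : A.carrier :=
  TensorProduct.rid ℂ A.carrier
    (((innerₛₗ ℂ a : A.carrier →ₗ[ℂ] ℂ).lTensor A.carrier) (A.comul (A.unit 1)))

end FrobAlg

/-- A quantum graph: a special symmetric dagger Frobenius algebra (the quantum set of vertices)
with a self-adjoint quantum adjacency matrix. The conditions `schur`, `transpose` and `reflexive`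
say, on a commutative algebra, that the entries are `0` or `1`, that the matrix is symmetric, and
that its diagonal entries are `1`. -/
structure QuantumGraph extends FrobAlg where
  adj : carrier →ₗ[ℂ] carrier
  adj_selfAdjoint : LinearMap.adjoint adj = adj
  schur : mul ∘ₗ TensorProduct.map adj adj ∘ₗ LinearMap.adjoint mul = adj
  transpose :
    (TensorProduct.rid ℂ carrier).toLinearMap ∘ₗ
      (LinearMap.adjoint unit ∘ₗ mul ∘ₗ adj.rTensor carrier).lTensor carrier ∘ₗ
      (TensorProduct.assoc ℂ carrier carrier carrier).toLinearMap ∘ₗ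
      (LinearMap.adjoint mul ∘ₗ unit).rTensor carrier ∘ₗ
      (TensorProduct.lid ℂ carrier).symm.toLinearMap = adj
  reflexive : mul ∘ₗ adj.rTensor carrier ∘ₗ LinearMap.adjoint mul = LinearMap.id

/-- An isomorphism of quantum graphs: a `*`-isomorphism of the vertex algebras (that is, a unitary
`*`-homomorphism) which intertwines the quantum adjacency matrices. -/
structure QuantumGraph.Iso (Q R : QuantumGraph) where
  toIsometryEquiv : Q.carrier ≃ₗᵢ[ℂ] R.carrier
  map_mul : ∀ a b, toIsometryEquiv (Q.mul (a ⊗ₜ b)) =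
    R.mul (toIsometryEquiv a ⊗ₜ toIsometryEquiv b)
  map_unit : ∀ c, toIsometryEquiv (Q.unit c) = R.unit c
  map_star : ∀ a, toIsometryEquiv (Q.star a) = R.star (toIsometryEquiv a)
  map_adj : ∀ a, toIsometryEquiv (Q.adj a) = R.adj (toIsometryEquiv a)

/-! A criterion for the axioms of a quantum graph, in terms of an involution `s` and of elements
`x i`, `y i` such that the comultiplication is `c ↦ ∑ i, c * x i ⊗ y i`. -/

section Criterion

variable {A ι : Type*} [NormedAddCommGroup A] [InnerProductSpace ℂ A]
  [Fintype ι]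

structure FrobCriterion (mul : A ⊗[ℂ] A →ₗ[ℂ] A) (unit : ℂ →ₗ[ℂ] A) (x y : ι → A) (s : A → A) :
    Prop where
  assoc : ∀ a b c, mul (mul (a ⊗ₜ b) ⊗ₜ c) = mul (a ⊗ₜ mul (b ⊗ₜ c))
  one_mul : ∀ a, mul (unit 1 ⊗ₜ a) = a
  mul_one : ∀ a, mul (a ⊗ₜ unit 1) = a
  inner_mul : ∀ a b c, inner ℂ (mul (a ⊗ₜ b)) c = inner ℂ a (mul (c ⊗ₜ s b))
  casimir : ∀ a b c, ∑ i, inner ℂ a (mul (c ⊗ₜ x i)) * inner ℂ b (y i) =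
    inner ℂ (mul (a ⊗ₜ b)) c
  sum_mul : ∑ i, mul (x i ⊗ₜ y i) = unit 1
  symm : ∀ a b, inner ℂ (unit 1) (mul (a ⊗ₜ b)) = inner ℂ (unit 1) (mul (b ⊗ₜ a))

variable {mul : A ⊗[ℂ] A →ₗ[ℂ] A} {unit : ℂ →ₗ[ℂ] A} {x y : ι → A} {s : A → A}

theorem FrobCriterion.adjoint_apply [FiniteDimensional ℂ A]
    (h : FrobCriterion mul unit x y s) (c : A) :
    LinearMap.adjoint mul c = ∑ i, mul (c ⊗ₜ x i) ⊗ₜ y i := by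
  rw [TensorProduct.ext_iff_inner_left]
  intro a b
  rw [LinearMap.adjoint_inner_right, inner_sum, ← h.casimir]
  simp

theorem FrobCriterion.inner_right (h : FrobCriterion mul unit x y s) (a b c : A) :
    inner ℂ c (mul (a ⊗ₜ b)) = inner ℂ (mul (c ⊗ₜ s b)) a := by
  rw [← inner_conj_symm, h.inner_mul, inner_conj_symm]

theorem adjoint_unit_apply [FiniteDimensional ℂ A] (a : A) : LinearMap.adjoint unit a = inner ℂ (unit 1) a := by
  have := LinearMap.adjoint_inner_right unit (1 : ℂ) a
  simpa using this

theorem FrobCriterion.snake (h : FrobCriterion mul unit x y s) (z : A) :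
    ∑ i, inner ℂ (unit 1) (mul (y i ⊗ₜ z)) • x i = z := by
  refine ext_inner_left ℂ fun p => ?_
  have := h.casimir p (mul (unit 1 ⊗ₜ s z)) (unit 1)
  simp only [inner_sum, inner_smul_right, h.inner_right]
  simp only [h.one_mul] at this ⊢
  simp only [mul_comm (inner ℂ p _)] at this
  rw [this, ← h.inner_right, h.one_mul]

/-- The Frobenius algebra given by the criterion. -/
@[reducible] noncomputable def FrobCriterion.toFrobAlg [FiniteDimensional ℂ A]
    (h : FrobCriterion mul unit x y s) :
    FrobAlg where
  carrier := A
  mul := mul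
  unit := unit
  mul_assoc := TensorProduct.ext_threefold fun a b c => by simp [h.assoc]
  unit_mul := TensorProduct.ext' fun c a => by
    have : unit c = c • unit 1 := by rw [← map_smul]; simp
    simp [this, ← TensorProduct.smul_tmul', h.one_mul]
  mul_unit := TensorProduct.ext' fun a c => by
    have : unit c = c • unit 1 := by rw [← map_smul]; simp
    simp [this, h.mul_one]
  frobenius_left := TensorProduct.ext' fun a b => by
    simp [h.adjoint_apply, TensorProduct.tmul_sum, h.assoc]
  frobenius_right := TensorProduct.ext' fun a b => by
    rw [TensorProduct.ext_iff_inner_left]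
    intro p q
    have key := h.casimir p (mul (q ⊗ₜ s b)) a
    simp only [LinearMap.comp_apply, LinearMap.rTensor_tmul,
      h.adjoint_apply, TensorProduct.sum_tmul, map_sum, LinearEquiv.coe_coe,
      TensorProduct.assoc_tmul, LinearMap.lTensor_tmul, inner_sum, TensorProduct.inner_tmul,
      h.inner_right _ b]
    rw [key, ← h.assoc, h.casimir, h.inner_right a b]
  special := LinearMap.ext fun c => by
    simp only [LinearMap.comp_apply, h.adjoint_apply, map_sum, h.assoc, LinearMap.id_apply]
    rw [← map_sum, ← TensorProduct.tmul_sum, h.sum_mul, h.mul_one]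
  symmetric := TensorProduct.ext' fun a b => by
    simp [adjoint_unit_apply, h.symm a b]

/-- The quantum graph given by the criterion. -/
@[reducible] noncomputable def FrobCriterion.toQuantumGraph [FiniteDimensional ℂ A]
    (h : FrobCriterion mul unit x y s)
    (adj : A →ₗ[ℂ] A) (hsa : ∀ a b, inner ℂ (adj a) b = inner ℂ a (adj b))
    (hschur : ∀ c, ∑ i, mul (adj (mul (c ⊗ₜ x i)) ⊗ₜ adj (y i)) = adj c)
    (htrans : ∀ a b, inner ℂ (unit 1) (mul (adj a ⊗ₜ b)) = inner ℂ (unit 1) (mul (a ⊗ₜ adj b)))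
    (hrefl : ∀ c, ∑ i, mul (adj (mul (c ⊗ₜ x i)) ⊗ₜ y i) = c) : QuantumGraph where
  toFrobAlg := h.toFrobAlg
  adj := adj
  adj_selfAdjoint := ((LinearMap.eq_adjoint_iff adj adj).2 hsa).symm
  schur := LinearMap.ext fun c => by
    simp [h.adjoint_apply, hschur]
  transpose := LinearMap.ext fun c => by
    simp [h.adjoint_apply, TensorProduct.sum_tmul, adjoint_unit_apply, htrans, h.one_mul, h.snake]
  reflexive := LinearMap.ext fun c => by
    simp [h.adjoint_apply, hrefl]

end Criterion

/-! ### Classical graphs as quantum graphs -/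

section Classical

variable {V : Type*} (G : SimpleGraph V)

open Classical in
/-- The adjacency matrix of a classical graph, with diagonal entries `1`. -/
noncomputable def adjEntry (v w : V) : ℂ := if v = w ∨ G.Adj v w then 1 else 0

theorem adjEntry_comm (v w : V) : adjEntry G v w = adjEntry G w v := by
  unfold adjEntry
  congr 1
  rw [G.adj_comm, eq_comm (a := v)]

theorem adjEntry_self (v : V) : adjEntry G v v = 1 := by simp [adjEntry]

theorem adjEntry_mul_self (v w : V) : adjEntry G v w * adjEntry G v w = adjEntry G v w := by
  unfold adjEntry; split_ifs <;> simp

theorem adjEntry_conj (v w : V) : (starRingEnd ℂ) (adjEntry G v w) = adjEntry G v w := by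
  unfold adjEntry; split_ifs <;> simp

theorem adjEntry_map (f : G ≃g G) (v w : V) : adjEntry G (f v) (f w) = adjEntry G v w := by
  unfold adjEntry
  congr 1
  rw [f.injective.eq_iff, f.map_adj_iff]

/-- The action of the adjacency matrix on functions on the vertices with values in `M`. -/
noncomputable def adjAction [Fintype V] (M : Type*) [AddCommGroup M] [Module ℂ M] :
    (V → M) →ₗ[ℂ] (V → M) where
  toFun x v := ∑ w, adjEntry G v w • x w
  map_add' x y := by ext; simp [Finset.sum_add_distrib]
  map_smul' c x := by ext; simp [Finset.smul_sum, smul_comm c]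

/-- The multiplication `e v ⊗ e w ↦ δ v w • e v` on `ℂ^V`. -/
noncomputable def classicalMul :
    EuclideanSpace ℂ V ⊗[ℂ] EuclideanSpace ℂ V →ₗ[ℂ] EuclideanSpace ℂ V :=
  TensorProduct.lift (LinearMap.mk₂ ℂ (fun x y => WithLp.toLp 2 fun v => x v * y v)
    (fun _ _ _ => by ext; simp [add_mul]) (fun _ _ _ => by ext; simp [mul_assoc])
    (fun _ _ _ => by ext; simp [mul_add]) (fun _ _ _ => by ext; simp [mul_left_comm]))

theorem classicalMul_tmul (x y : EuclideanSpace ℂ V) (v : V) :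
    classicalMul (x ⊗ₜ y) v = x v * y v := rfl

/-- The unit `1 ↦ ∑ v, e v` of `ℂ^V`. -/
noncomputable def classicalUnit : ℂ →ₗ[ℂ] EuclideanSpace ℂ V :=
  LinearMap.toSpanSingleton ℂ _ (WithLp.toLp 2 fun _ => 1)

theorem classicalUnit_one (v : V) : (classicalUnit 1 : EuclideanSpace ℂ V) v = 1 := by
  simp [classicalUnit]

variable [Fintype V]

noncomputable def classicalAdj : EuclideanSpace ℂ V →ₗ[ℂ] EuclideanSpace ℂ V :=
  (WithLp.linearEquiv 2 ℂ (V → ℂ)).symm.toLinearMap ∘ₗ adjAction G ℂ ∘ₗ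
    (WithLp.linearEquiv 2 ℂ (V → ℂ)).toLinearMap

theorem classicalAdj_apply (x : EuclideanSpace ℂ V) (v : V) :
    classicalAdj G x v = ∑ w, adjEntry G v w * x w := rfl

open Classical in
theorem classical_criterion : FrobCriterion (classicalMul (V := V)) classicalUnit
    (fun v => EuclideanSpace.single v (1 : ℂ)) (fun v => EuclideanSpace.single v (1 : ℂ))
    (fun a => WithLp.toLp 2 fun v => (starRingEnd ℂ) (a v)) where
  assoc a b c := by ext; simp [classicalMul_tmul, mul_assoc]
  one_mul a := by ext; simp [classicalMul_tmul, classicalUnit_one]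
  mul_one a := by ext; simp [classicalMul_tmul, classicalUnit_one]
  inner_mul a b c := by
    simp only [PiLp.inner_apply, classicalMul_tmul, RCLike.inner_apply, map_mul]
    exact Finset.sum_congr rfl fun _ _ => by ring
  casimir a b c := by
    simp only [PiLp.inner_apply, classicalMul_tmul, RCLike.inner_apply, map_mul]
    simp [mul_comm, mul_left_comm]
  sum_mul := by
    ext v
    simp [classicalMul_tmul, classicalUnit_one]
  symm a b := by
    simp [PiLp.inner_apply, classicalMul_tmul, mul_comm]

open Classical in
/-- A classical graph, as a quantum graph on the commutative algebra `ℂ^V`. -/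
noncomputable def QuantumGraph.ofSimpleGraph : QuantumGraph :=
  classical_criterion.toQuantumGraph (classicalAdj G)
    (fun a b => by
      simp only [PiLp.inner_apply, classicalAdj_apply, RCLike.inner_apply, map_sum, map_mul,
        adjEntry_conj, Finset.mul_sum, Finset.sum_mul]
      rw [Finset.sum_comm]
      refine Finset.sum_congr rfl fun v _ => Finset.sum_congr rfl fun w _ => ?_
      rw [adjEntry_comm]; ring)
    (fun c => by
      ext v
      simp [classicalMul_tmul, classicalAdj_apply]
      refine Finset.sum_congr rfl fun w _ => ?_
      rw [mul_right_comm, adjEntry_mul_self])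
    (fun a b => by
      simp only [PiLp.inner_apply, classicalAdj_apply, classicalMul_tmul, RCLike.inner_apply,
        classicalUnit_one, map_one, mul_one, Finset.mul_sum, Finset.sum_mul]
      rw [Finset.sum_comm]
      refine Finset.sum_congr rfl fun v _ => Finset.sum_congr rfl fun w _ => ?_
      rw [adjEntry_comm]; ring)
    (fun c => by
      ext v
      simp [classicalMul_tmul, classicalAdj_apply, adjEntry_self])

end Classical

/-! ### Groups of central type and nice unitary error bases -/

/-- A `2`-cocycle on the group `L` with values in `U(1)`. -/
def IsTwoCocycle {L : Type*} [Group L] (ψ : L → L → Circle) : Prop :=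
  ∀ a b c, ψ a b * ψ (a * b) c = ψ a (b * c) * ψ b c

/-- The twisted group algebra `ℂL^ψ`; the function `f` stands for `∑ a, f a • a`. -/
def TwistedGroupAlgebra {L : Type*} (_ψ : L → L → Circle) : Type _ := L → ℂ

namespace TwistedGroupAlgebra

variable {L : Type*} [Group L] [Fintype L] (ψ : L → L → Circle)

instance : AddCommGroup (TwistedGroupAlgebra ψ) := inferInstanceAs (AddCommGroup (L → ℂ))

/-- The bilinear multiplication with `a ⋆ b = (1 / √|L|) ψ(a, b) ab` for `a b : L`. -/
noncomputable instance : Mul (TwistedGroupAlgebra ψ) where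
  mul f g := fun c => (1 / ((√(Fintype.card L : ℝ) : ℝ) : ℂ)) *
    ∑ a : L, (ψ a (a⁻¹ * c) : ℂ) * f a * g (a⁻¹ * c)

theorem mul_apply (f g : TwistedGroupAlgebra ψ) (c : L) :
    (f * g) c = (1 / ((√(Fintype.card L : ℝ) : ℝ) : ℂ)) *
      ∑ a : L, (ψ a (a⁻¹ * c) : ℂ) * f a * g (a⁻¹ * c) := rfl

theorem add_apply (f g : TwistedGroupAlgebra ψ) (c : L) : (f + g) c = f c + g c := rfl

theorem zero_apply (c : L) : (0 : TwistedGroupAlgebra ψ) c = 0 := rfl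

noncomputable instance : NonUnitalNonAssocRing (TwistedGroupAlgebra ψ) where
  left_distrib f g h := funext fun c => by
    simp [mul_apply, add_apply, mul_add, Finset.sum_add_distrib]
  right_distrib f g h := funext fun c => by
    simp [mul_apply, add_apply, mul_add, add_mul, Finset.sum_add_distrib]
  zero_mul f := funext fun c => by simp [mul_apply, zero_apply]
  mul_zero f := funext fun c => by simp [mul_apply, zero_apply]

end TwistedGroupAlgebra

/-- `(L, ψ)` is a group of central type: `ψ` is a non-degenerate `2`-cocycle on the finite group
`L`, that is, the twisted group algebra is simple. -/
structure IsCentralType {L : Type*} [Group L] [Fintype L] (ψ : L → L → Circle) : Prop where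
  cocycle : IsTwoCocycle ψ
  simple : IsSimpleRing (TwistedGroupAlgebra ψ)

open Classical in
/-- A nice unitary error basis for `(L, ψ)` on the finite-dimensional Hilbert space `H`. -/
structure IsNiceUEB {L : Type*} [Group L] [Fintype L] (ψ : L → L → Circle)
    {H : Type*} [NormedAddCommGroup H] [InnerProductSpace ℂ H] [FiniteDimensional ℂ H]
    (U : L → (H →ₗ[ℂ] H)) : Prop where
  unitary : ∀ a, LinearMap.adjoint (U a) * U a = 1 ∧ U a * LinearMap.adjoint (U a) = 1
  card_eq : Fintype.card L = Module.finrank ℂ H ^ 2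
  trace_eq : ∀ a b, LinearMap.trace ℂ H (LinearMap.adjoint (U a) * U b) =
    if a = b then (Module.finrank ℂ H : ℂ) else 0
  mul_eq : ∀ a b, U a * U b = (ψ a b : ℂ) • U (a * b)

/-! ### The quantum graph induced by a subgroup of central type -/

section Operators

variable {H : Type*} [NormedAddCommGroup H] [InnerProductSpace ℂ H] [FiniteDimensional ℂ H]

/-- The operator `|x⟩⟨y|`. -/
noncomputable def ketBra (x y : H) : H →ₗ[ℂ] H := (innerₛₗ ℂ y : H →ₗ[ℂ] ℂ).smulRight x

theorem ketBra_apply (x y z : H) : ketBra x y z = (inner ℂ y z : ℂ) • x := rfl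

theorem trace_mul_ketBra (M : H →ₗ[ℂ] H) (x y : H) :
    LinearMap.trace ℂ H (M * ketBra x y) = inner ℂ y (M x) := by
  rw [LinearMap.trace_eq_sum_inner _ (stdOrthonormalBasis ℂ H)]
  simp only [Module.End.mul_apply, ketBra_apply, map_smul, inner_smul_right]
  rw [← OrthonormalBasis.sum_inner_mul_inner (stdOrthonormalBasis ℂ H) y (M x)]

/-- Bending wires: a linear map `Φ` on `End(H) = H ⊗ H*` is turned by a quarter, so that
`M ↦ Tr(L† M) K` becomes `M ↦ K M L†`. -/
noncomputable def bend :
    ((H →ₗ[ℂ] H) →ₗ[ℂ] (H →ₗ[ℂ] H)) →ₗ[ℂ] (H →ₗ[ℂ] H) →ₗ[ℂ] (H →ₗ[ℂ] H) :=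
  LinearMap.mk₂ ℂ (fun Φ M => ∑ i, ∑ j,
      Φ (ketBra (stdOrthonormalBasis ℂ H i) (stdOrthonormalBasis ℂ H j)) * M *
        ketBra (stdOrthonormalBasis ℂ H j) (stdOrthonormalBasis ℂ H i))
    (fun _ _ _ => by simp [add_mul, Finset.sum_add_distrib])
    (fun _ _ _ => by simp [Finset.smul_sum])
    (fun _ _ _ => by simp [mul_add, add_mul, Finset.sum_add_distrib])
    (fun _ _ _ => by simp [Finset.smul_sum])

/-- The map `M ↦ Tr(L† M) K`, that is, `|K⟩⟨L|` on `End(H)`. -/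
noncomputable def traceMap (K L : H →ₗ[ℂ] H) : (H →ₗ[ℂ] H) →ₗ[ℂ] (H →ₗ[ℂ] H) where
  toFun M := LinearMap.trace ℂ H (LinearMap.adjoint L * M) • K
  map_add' M N := by simp [mul_add, add_smul]
  map_smul' c M := by simp [smul_smul]

theorem bend_traceMap (K L M : H →ₗ[ℂ] H) :
    bend (traceMap K L) M = K * M * LinearMap.adjoint L := by
  ext z
  have hz : LinearMap.adjoint L z = ∑ j, ∑ i,
      (inner ℂ (L (stdOrthonormalBasis ℂ H j)) (stdOrthonormalBasis ℂ H i) *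
        inner ℂ (stdOrthonormalBasis ℂ H i) z : ℂ) • stdOrthonormalBasis ℂ H j := by
    conv_lhs => rw [← OrthonormalBasis.sum_repr' (stdOrthonormalBasis ℂ H) (LinearMap.adjoint L z)]
    refine Finset.sum_congr rfl fun j _ => ?_
    rw [← Finset.sum_smul, OrthonormalBasis.sum_inner_mul_inner, LinearMap.adjoint_inner_right]
  simp only [Module.End.mul_apply, hz, map_sum, map_smul]
  simp only [bend, LinearMap.mk₂_apply, traceMap, LinearMap.coe_mk, AddHom.coe_mk, trace_mul_ketBra,
    LinearMap.sum_apply, Module.End.mul_apply, ketBra_apply, map_smul, LinearMap.smul_apply,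
    smul_smul, LinearMap.adjoint_inner_right]
  rw [Finset.sum_comm]
  simp only [mul_comm]

theorem sum_ketBra_mul (M : H →ₗ[ℂ] H) :
    ∑ i, ∑ j, ketBra (stdOrthonormalBasis ℂ H i) (stdOrthonormalBasis ℂ H j) * M *
      ketBra (stdOrthonormalBasis ℂ H j) (stdOrthonormalBasis ℂ H i) =
      LinearMap.trace ℂ H M • (1 : H →ₗ[ℂ] H) := by
  ext z
  simp only [LinearMap.sum_apply, Module.End.mul_apply, ketBra_apply, map_smul,
    LinearMap.smul_apply, Module.End.one_apply, smul_smul]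
  rw [LinearMap.trace_eq_sum_inner _ (stdOrthonormalBasis ℂ H)]
  conv_rhs => rw [← OrthonormalBasis.sum_repr' (stdOrthonormalBasis ℂ H) z]
  rw [Finset.smul_sum]
  refine Finset.sum_congr rfl fun i _ => ?_
  rw [smul_smul, Finset.sum_mul, Finset.sum_smul]
  simp only [mul_comm]

theorem sum_inner_mul_inner (M N : H →ₗ[ℂ] H) :
    ∑ i, ∑ j, (inner ℂ (stdOrthonormalBasis ℂ H j) (M (stdOrthonormalBasis ℂ H i)) : ℂ) *
      inner ℂ (stdOrthonormalBasis ℂ H i) (N (stdOrthonormalBasis ℂ H j)) =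
      LinearMap.trace ℂ H (M * N) := by
  rw [LinearMap.trace_eq_sum_inner _ (stdOrthonormalBasis ℂ H), Finset.sum_comm]
  refine Finset.sum_congr rfl fun j _ => ?_
  simp only [Module.End.mul_apply]
  rw [← LinearMap.adjoint_inner_left,
    ← OrthonormalBasis.sum_inner_mul_inner (stdOrthonormalBasis ℂ H)]
  simp only [LinearMap.adjoint_inner_left]

/-- The Hilbert space `H* ⊗ ℂ^V ⊗ H`, as functions from `V` to the operators on `H`, with the
Hilbert-Schmidt inner product. -/
def OpFun (V H : Type*) [NormedAddCommGroup H] [InnerProductSpace ℂ H] : Type _ := V → (H →ₗ[ℂ] H)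

variable {V : Type*}

noncomputable instance : AddCommGroup (OpFun V H) :=
  inferInstanceAs (AddCommGroup (V → (H →ₗ[ℂ] H)))

noncomputable instance : Module ℂ (OpFun V H) :=
  inferInstanceAs (Module ℂ (V → (H →ₗ[ℂ] H)))

variable [Fintype V]

instance : FiniteDimensional ℂ (OpFun V H) :=
  inferInstanceAs (FiniteDimensional ℂ (V → (H →ₗ[ℂ] H)))

theorem trace_adjoint_mul (A B : H →ₗ[ℂ] H) : LinearMap.trace ℂ H (LinearMap.adjoint A * B) =
    ∑ i, inner ℂ (A (stdOrthonormalBasis ℂ H i)) (B (stdOrthonormalBasis ℂ H i)) := by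
  rw [LinearMap.trace_eq_sum_inner _ (stdOrthonormalBasis ℂ H)]
  simp [LinearMap.adjoint_inner_right]

theorem trace_adjoint_mul_self (A : H →ₗ[ℂ] H) : LinearMap.trace ℂ H (LinearMap.adjoint A * A) =
    ((∑ i, ‖A (stdOrthonormalBasis ℂ H i)‖ ^ 2 : ℝ) : ℂ) := by
  rw [trace_adjoint_mul]
  push_cast
  exact Finset.sum_congr rfl fun i _ => inner_self_eq_norm_sq_to_K _

/-- The Hilbert-Schmidt inner product `⟨F, G⟩ = ∑ v, Tr(F(v)† G(v))`. -/
@[reducible] noncomputable def OpFun.core : InnerProductSpace.Core ℂ (OpFun V H) where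
  inner F G := ∑ v, LinearMap.trace ℂ H (LinearMap.adjoint (F v) * G v)
  conj_inner_symm F G := by
    simp only [trace_adjoint_mul, map_sum, inner_conj_symm]
  re_inner_nonneg F := by
    simp only [trace_adjoint_mul_self, map_sum]
    refine Finset.sum_nonneg fun v _ => ?_
    rw [RCLike.re_eq_complex_re, Complex.ofReal_re]
    exact Finset.sum_nonneg fun i _ => by positivity
  add_left F G K := by
    simp only [trace_adjoint_mul, ← Finset.sum_add_distrib, ← inner_add_left]
    rfl
  smul_left F G r := by
    simp only [trace_adjoint_mul, Finset.mul_sum, ← inner_smul_left]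
    rfl
  definite F h := by
    simp only [trace_adjoint_mul_self] at h
    have h' : ∑ v, ∑ i, ‖F v (stdOrthonormalBasis ℂ H i)‖ ^ 2 = 0 := by exact_mod_cast h
    refine funext fun v => (stdOrthonormalBasis ℂ H).toBasis.ext fun i => ?_
    have h1 := (Finset.sum_eq_zero_iff_of_nonneg fun v _ =>
      Finset.sum_nonneg fun i _ => by positivity).1 h' v (Finset.mem_univ v)
    have h2 := (Finset.sum_eq_zero_iff_of_nonneg fun i _ => by positivity).1 h1 i
      (Finset.mem_univ i)
    exact (by simpa using h2 : F v (stdOrthonormalBasis ℂ H i) = 0).trans (by simp; rfl)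

noncomputable instance : NormedAddCommGroup (OpFun V H) := OpFun.core.toNormedAddCommGroup

noncomputable instance : InnerProductSpace ℂ (OpFun V H) := InnerProductSpace.ofCore _

theorem OpFun.inner_def (F G : OpFun V H) :
    inner ℂ F G = ∑ v, LinearMap.trace ℂ H (LinearMap.adjoint (F v) * G v) := rfl

/-- The multiplication of `ℂ^V ⊗ End(H)`. -/
noncomputable def OpFun.mul : OpFun V H ⊗[ℂ] OpFun V H →ₗ[ℂ] OpFun V H :=
  TensorProduct.lift (LinearMap.mk₂ ℂ (fun F G v => F v * G v)
    (fun _ _ _ => funext fun _ => add_mul _ _ _)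
    (fun c F G => funext fun v => (smul_mul_assoc c (F v) (G v) : (c • F v) * G v = _))
    (fun _ _ _ => funext fun _ => mul_add _ _ _)
    (fun c F G => funext fun v => (mul_smul_comm c (F v) (G v) : F v * (c • G v) = _)))

theorem OpFun.mul_tmul (F G : OpFun V H) (v : V) : OpFun.mul (F ⊗ₜ G) v = F v * G v := rfl

/-- The unit of `ℂ^V ⊗ End(H)`. -/
def OpFun.one : OpFun V H := fun _ => 1

theorem OpFun.one_apply (v : V) : (OpFun.one : OpFun V H) v = 1 := rfl

/-- The function with values `F(v)†`. -/
noncomputable def OpFun.adjoint (F : OpFun V H) : OpFun V H := fun v => LinearMap.adjoint (F v)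

theorem OpFun.adjoint_apply (F : OpFun V H) (v : V) :
    F.adjoint v = LinearMap.adjoint (F v) := rfl

open Classical in
/-- The function with value `M` at `v` and `0` elsewhere. -/
noncomputable def OpFun.single (v : V) (M : H →ₗ[ℂ] H) : OpFun V H :=
  fun w => if w = v then M else 0

theorem OpFun.single_self (v : V) (M : H →ₗ[ℂ] H) : OpFun.single v M v = M := if_pos rfl

theorem OpFun.single_ne {v w : V} (h : w ≠ v) (M : H →ₗ[ℂ] H) : OpFun.single v M w = 0 :=
  if_neg h

/-- The adjacency matrix of a classical graph, acting on the tensor factor `ℂ^V`. -/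
noncomputable def OpFun.adj (G : SimpleGraph V) : OpFun V H →ₗ[ℂ] OpFun V H :=
  adjAction G (H →ₗ[ℂ] H)

theorem OpFun.adj_apply (G : SimpleGraph V) (F : OpFun V H) (v : V) :
    OpFun.adj G F v = ∑ w, adjEntry G v w • F w := rfl

end Operators

section Induced

variable {V L H : Type*} [Fintype V] [Group L] [Fintype L]
  [NormedAddCommGroup H] [InnerProductSpace ℂ H] [FiniteDimensional ℂ H]
  {G : SimpleGraph V} (φ : L →* (G ≃g G)) {ψ : L → L → Circle} (U : L → (H →ₗ[ℂ] H))

open Classical in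
/-- The component at the vertices `v` (input) and `w` (output) of the simple dagger Frobenius monoid
`X_{L,ψ}`, an operator on `End(H)`: the sum of the operators `(1 / √|L|) |U_a⟩⟨U_a|` over the
elements `a` of `L` with `a(v) = w`. -/
noncomputable def simpleMonoid (v w : V) : (H →ₗ[ℂ] H) →ₗ[ℂ] (H →ₗ[ℂ] H) :=
  (1 / ((√(Fintype.card L : ℝ) : ℝ) : ℂ)) •
    ∑ a : L, if φ a v = w then traceMap (U a) (U a) else 0

/-- The dagger idempotent on `H* ⊗ ℂ^V ⊗ H` obtained from `(1 / dim H) X_{L,ψ}` by bending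
wires. -/
noncomputable def bentIdempotent : OpFun V H →ₗ[ℂ] OpFun V H where
  toFun F w := (1 / (Module.finrank ℂ H : ℂ)) • ∑ v, bend (simpleMonoid φ U v w) (F v)
  map_add' F K := funext fun w => by
    have : ∀ v, (F + K) v = F v + K v := fun _ => rfl
    simp only [this, map_add, Finset.sum_add_distrib, smul_add]
    rfl
  map_smul' c F := funext fun w => by
    have : ∀ v, (c • F) v = c • F v := fun _ => rfl
    simp only [this, map_smul, ← Finset.smul_sum]
    exact smul_comm _ _ _

/-- The Hilbert space obtained by splitting the dagger idempotent: its image. -/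
noncomputable abbrev InducedSpace : Submodule ℂ (OpFun V H) := LinearMap.range (bentIdempotent φ U)

/-- The isometry which splits the dagger idempotent. -/
noncomputable def inducedIncl : InducedSpace φ U →ₗ[ℂ] OpFun V H := (InducedSpace φ U).subtype

/-- The multiplication on the image of the idempotent: that of `ℂ^V`, surrounded by a circle
labelled `H`, with the normalisation `1 / dim H` of the circle and the factor `√(dim H)` of each of
the three nodes in which the circle meets the wires. -/
noncomputable def inducedMul :
    InducedSpace φ U ⊗[ℂ] InducedSpace φ U →ₗ[ℂ] InducedSpace φ U :=
  (1 / (Module.finrank ℂ H : ℂ) * ((√(Module.finrank ℂ H : ℝ) : ℝ) : ℂ) ^ 3) •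
    (LinearMap.adjoint (inducedIncl φ U) ∘ₗ OpFun.mul ∘ₗ
      TensorProduct.map (inducedIncl φ U) (inducedIncl φ U))

/-- The unit, which has only one such node. -/
noncomputable def inducedUnit : ℂ →ₗ[ℂ] InducedSpace φ U :=
  (1 / (Module.finrank ℂ H : ℂ) * ((√(Module.finrank ℂ H : ℝ) : ℝ) : ℂ)) •
    (LinearMap.adjoint (inducedIncl φ U) ∘ₗ
      LinearMap.toSpanSingleton ℂ (OpFun V H) OpFun.one)

/-- The quantum adjacency matrix, which has two such nodes. -/
noncomputable def inducedAdj : InducedSpace φ U →ₗ[ℂ] InducedSpace φ U :=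
  (1 / (Module.finrank ℂ H : ℂ) * ((√(Module.finrank ℂ H : ℝ) : ℝ) : ℂ) ^ 2) •
    (LinearMap.adjoint (inducedIncl φ U) ∘ₗ OpFun.adj G ∘ₗ inducedIncl φ U)

section Facts

variable {U}

theorem IsNiceUEB.finrank_ne_zero (hU : IsNiceUEB ψ U) : (Module.finrank ℂ H : ℂ) ≠ 0 := by
  have h := hU.card_eq
  have h0 : Fintype.card L ≠ 0 := Fintype.card_ne_zero
  rw [h] at h0
  exact_mod_cast fun h1 => h0 (by rw [h1]; rfl)

theorem sqrt_finrank_sq : ((√(Module.finrank ℂ H : ℝ) : ℝ) : ℂ) ^ 2 = Module.finrank ℂ H := by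
  rw [← Complex.ofReal_pow, Real.sq_sqrt (Nat.cast_nonneg _), Complex.ofReal_natCast]

theorem IsNiceUEB.sqrt_finrank_ne_zero (hU : IsNiceUEB ψ U) :
    ((√(Module.finrank ℂ H : ℝ) : ℝ) : ℂ) ≠ 0 := by
  intro h
  apply hU.finrank_ne_zero
  rw [← sqrt_finrank_sq, h]
  simp

theorem IsNiceUEB.card_eq' (hU : IsNiceUEB ψ U) :
    (Fintype.card L : ℂ) = (Module.finrank ℂ H : ℂ) ^ 2 := by
  rw [hU.card_eq]; push_cast; rfl

theorem IsNiceUEB.sqrt_card (hU : IsNiceUEB ψ U) :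
    ((√(Fintype.card L : ℝ) : ℝ) : ℂ) = Module.finrank ℂ H := by
  rw [hU.card_eq]
  push_cast
  rw [Real.sqrt_sq (Nat.cast_nonneg _), Complex.ofReal_natCast]

/-- Conjugation by `U` is an action of `L`. -/
theorem IsNiceUEB.conj_mul (hU : IsNiceUEB ψ U) (a b : L) (M : H →ₗ[ℂ] H) :
    U (a * b) * M * LinearMap.adjoint (U (a * b)) =
      U a * (U b * M * LinearMap.adjoint (U b)) * LinearMap.adjoint (U a) := by
  have h1 := hU.mul_eq a b
  have h2 : LinearMap.adjoint (U b) * LinearMap.adjoint (U a) =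
      (starRingEnd ℂ) (ψ a b : ℂ) • LinearMap.adjoint (U (a * b)) := by
    have := congrArg LinearMap.adjoint h1
    rw [map_smulₛₗ, Module.End.mul_eq_comp, LinearMap.adjoint_comp] at this
    exact this
  calc U (a * b) * M * LinearMap.adjoint (U (a * b))
      = ((ψ a b : ℂ) • U (a * b)) * M *
          ((starRingEnd ℂ) (ψ a b : ℂ) • LinearMap.adjoint (U (a * b))) := by
        rw [smul_mul_assoc, smul_mul_assoc, mul_smul_comm, smul_smul, Complex.mul_conj,
          Circle.normSq_coe, Complex.ofReal_one, one_smul]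
    _ = _ := by rw [← h1, ← h2]; simp only [mul_assoc]

theorem bend_simpleMonoid (v w : V) (M : H →ₗ[ℂ] H) [DecidableEq V] :
    bend (simpleMonoid φ U v w) M = (1 / ((√(Fintype.card L : ℝ) : ℝ) : ℂ)) •
      ∑ a : L, if v = φ a⁻¹ w then U a * M * LinearMap.adjoint (U a) else 0 := by
  unfold simpleMonoid
  rw [map_smul, map_sum, LinearMap.smul_apply, LinearMap.sum_apply]
  congr 1
  refine Finset.sum_congr rfl fun a _ => ?_
  have : φ a v = w ↔ v = φ a⁻¹ w := by
    rw [map_inv]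
    constructor
    · rintro rfl; exact ((φ a).symm_apply_apply v).symm
    · rintro rfl; exact (φ a).apply_symm_apply w
  by_cases h : φ a v = w
  · rw [if_pos h, if_pos (this.1 h), bend_traceMap]
  · rw [if_neg h, if_neg (fun h' => h (this.2 h'))]; simp

theorem bentIdempotent_apply (hU : IsNiceUEB ψ U) (F : OpFun V H) (w : V) :
    bentIdempotent φ U F w = (1 / (Fintype.card L : ℂ)) •
      ∑ a : L, U a * F (φ a⁻¹ w) * LinearMap.adjoint (U a) := by
  classical
  have : bentIdempotent φ U F w =
    (1 / (Module.finrank ℂ H : ℂ)) • ∑ v, bend (simpleMonoid φ U v w) (F v) := rfl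
  simp only [this, bend_simpleMonoid]
  rw [← Finset.smul_sum, smul_smul, Finset.sum_comm, hU.sqrt_card, hU.card_eq']
  congr 1
  · ring
  · simp

/-- The image of the idempotent consists of the `L`-equivariant functions. -/
theorem mem_inducedSpace (hU : IsNiceUEB ψ U) (F : OpFun V H) : F ∈ InducedSpace φ U ↔
    ∀ a w, F (φ a w) = U a * F w * LinearMap.adjoint (U a) := by
  constructor
  · rintro ⟨K, rfl⟩ a w
    rw [bentIdempotent_apply φ hU, bentIdempotent_apply φ hU, mul_smul_comm, smul_mul_assoc,
      Finset.mul_sum, Finset.sum_mul]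
    congr 1
    rw [← Equiv.sum_comp (Equiv.mulLeft a)]
    refine Finset.sum_congr rfl fun b _ => ?_
    rw [Equiv.coe_mulLeft, hU.conj_mul]
    congr 4
    rw [mul_inv_rev, map_mul, RelIso.mul_apply, ← RelIso.mul_apply (φ a⁻¹), ← map_mul]
    simp
  · intro h
    refine ⟨F, funext fun w => ?_⟩
    rw [bentIdempotent_apply φ hU]
    have : ∀ a : L, U a * F (φ a⁻¹ w) * LinearMap.adjoint (U a) = F w := fun a => by
      rw [← h, ← RelIso.mul_apply, ← map_mul]; simp
    simp only [this, Finset.sum_const, Finset.card_univ]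
    rw [← Nat.cast_smul_eq_nsmul ℂ, smul_smul, one_div, inv_mul_cancel₀, one_smul]
    rw [hU.card_eq']
    exact pow_ne_zero _ hU.finrank_ne_zero

theorem inner_bentIdempotent (hU : IsNiceUEB ψ U) (F K : OpFun V H) (hF : F ∈ InducedSpace φ U) :
    inner ℂ F (bentIdempotent φ U K) = inner ℂ F K := by
  rw [mem_inducedSpace φ hU] at hF
  simp only [OpFun.inner_def, bentIdempotent_apply φ hU, mul_smul_comm, map_smul, Finset.mul_sum,
    map_sum, ← Finset.smul_sum]
  rw [Finset.sum_comm]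
  have : ∀ a : L, ∑ w, LinearMap.trace ℂ H (LinearMap.adjoint (F w) *
      (U a * K (φ a⁻¹ w) * LinearMap.adjoint (U a))) =
      ∑ w, LinearMap.trace ℂ H (LinearMap.adjoint (F w) * K w) := fun a => by
    rw [← (φ a).toEquiv.sum_comp]
    refine Finset.sum_congr rfl fun w _ => ?_
    have h1 : φ a⁻¹ (φ a w) = w := by rw [← RelIso.mul_apply, ← map_mul]; simp
    have h2 : LinearMap.adjoint (F (φ a w)) =
        U a * LinearMap.adjoint (F w) * LinearMap.adjoint (U a) := by
      rw [hF]
      simp only [Module.End.mul_eq_comp, LinearMap.adjoint_comp, LinearMap.adjoint_adjoint,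
        LinearMap.comp_assoc]
    change LinearMap.trace ℂ H (LinearMap.adjoint (F (φ a w)) *
      (U a * K (φ a⁻¹ (φ a w)) * LinearMap.adjoint (U a))) = _
    rw [h1, h2, LinearMap.trace_mul_comm]
    have : U a * K w * LinearMap.adjoint (U a) *
        (U a * LinearMap.adjoint (F w) * LinearMap.adjoint (U a)) =
        U a * (K w * (LinearMap.adjoint (U a) * U a) * LinearMap.adjoint (F w) *
          LinearMap.adjoint (U a)) := by simp only [mul_assoc]
    rw [this, (hU.unitary a).1, mul_one, LinearMap.trace_mul_comm, mul_assoc, (hU.unitary a).1,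
      mul_one, LinearMap.trace_mul_comm]
  simp only [this, Finset.sum_const, Finset.card_univ]
  rw [← Nat.cast_smul_eq_nsmul ℂ, smul_smul, one_div, inv_mul_cancel₀, one_smul]
  rw [hU.card_eq']
  exact pow_ne_zero _ hU.finrank_ne_zero

theorem adjoint_inducedIncl (F : OpFun V H) (hF : F ∈ InducedSpace φ U) :
    LinearMap.adjoint (inducedIncl φ U) F = ⟨F, hF⟩ := by
  refine ext_inner_left ℂ fun K => ?_
  rw [LinearMap.adjoint_inner_right]
  rfl

theorem inducedMul_apply (hU : IsNiceUEB ψ U) (a b : InducedSpace φ U) (v : V) :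
    (inducedMul φ U (a ⊗ₜ b) : OpFun V H) v =
      ((√(Module.finrank ℂ H : ℝ) : ℝ) : ℂ) • ((a : OpFun V H) v * (b : OpFun V H) v) := by
  have hab : OpFun.mul ((a : OpFun V H) ⊗ₜ (b : OpFun V H)) ∈ InducedSpace φ U := by
    rw [mem_inducedSpace φ hU]
    intro g w
    rw [OpFun.mul_tmul, OpFun.mul_tmul, (mem_inducedSpace φ hU _).1 a.2,
      (mem_inducedSpace φ hU _).1 b.2]
    calc _ = U g * (a : OpFun V H) w * (LinearMap.adjoint (U g) * U g) * (b : OpFun V H) w *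
          LinearMap.adjoint (U g) := by simp only [mul_assoc]
      _ = _ := by rw [(hU.unitary g).1]; simp only [mul_assoc, mul_one]
  have h : inducedMul φ U (a ⊗ₜ b) =
      (1 / (Module.finrank ℂ H : ℂ) * ((√(Module.finrank ℂ H : ℝ) : ℝ) : ℂ) ^ 3) •
      (⟨_, hab⟩ : InducedSpace φ U) := by
    rw [← adjoint_inducedIncl φ _ hab]; rfl
  rw [h]
  have hn : (1 / (Module.finrank ℂ H : ℂ) * ((√(Module.finrank ℂ H : ℝ) : ℝ) : ℂ) ^ 3) =
      ((√(Module.finrank ℂ H : ℝ) : ℝ) : ℂ) := by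
    rw [pow_succ, sqrt_finrank_sq, ← mul_assoc, one_div, inv_mul_cancel₀ hU.finrank_ne_zero,
      one_mul]
  rw [hn]
  rfl

theorem inducedUnit_apply (hU : IsNiceUEB ψ U) (v : V) :
    (inducedUnit φ U 1 : OpFun V H) v =
      (((√(Module.finrank ℂ H : ℝ) : ℝ) : ℂ))⁻¹ • (1 : H →ₗ[ℂ] H) := by
  have h1 : (OpFun.one : OpFun V H) ∈ InducedSpace φ U := by
    rw [mem_inducedSpace φ hU]
    intro g w
    rw [OpFun.one_apply, OpFun.one_apply, mul_one, (hU.unitary g).2]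
  have h : inducedUnit φ U 1 =
      (1 / (Module.finrank ℂ H : ℂ) * ((√(Module.finrank ℂ H : ℝ) : ℝ) : ℂ)) •
      (⟨_, h1⟩ : InducedSpace φ U) := by
    rw [← adjoint_inducedIncl φ _ h1, inducedUnit, LinearMap.smul_apply, LinearMap.comp_apply,
      LinearMap.toSpanSingleton_apply, one_smul]
  rw [h]
  have hn : (1 / (Module.finrank ℂ H : ℂ) * ((√(Module.finrank ℂ H : ℝ) : ℝ) : ℂ)) =
      (((√(Module.finrank ℂ H : ℝ) : ℝ) : ℂ))⁻¹ := by
    rw [← sqrt_finrank_sq]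
    have := hU.sqrt_finrank_ne_zero
    field_simp
  rw [hn]
  rfl

theorem inducedAdj_apply (hU : IsNiceUEB ψ U) (a : InducedSpace φ U) (v : V) :
    (inducedAdj φ U a : OpFun V H) v = ∑ w, adjEntry G v w • (a : OpFun V H) w := by
  have ha : OpFun.adj G (a : OpFun V H) ∈ InducedSpace φ U := by
    rw [mem_inducedSpace φ hU]
    intro g w
    change ∑ u, adjEntry G (φ g w) u • (a : OpFun V H) u =
      U g * (∑ u, adjEntry G w u • (a : OpFun V H) u) * LinearMap.adjoint (U g)
    rw [← (φ g).toEquiv.sum_comp, Finset.mul_sum, Finset.sum_mul]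
    refine Finset.sum_congr rfl fun u _ => ?_
    change adjEntry G (φ g w) (φ g u) • (a : OpFun V H) (φ g u) = _
    rw [adjEntry_map, (mem_inducedSpace φ hU _).1 a.2, mul_smul_comm, smul_mul_assoc]
  have h : inducedAdj φ U a =
      (1 / (Module.finrank ℂ H : ℂ) * ((√(Module.finrank ℂ H : ℝ) : ℝ) : ℂ) ^ 2) •
      (⟨_, ha⟩ : InducedSpace φ U) := by
    rw [← adjoint_inducedIncl φ _ ha]; rfl
  rw [h, sqrt_finrank_sq, one_div, inv_mul_cancel₀ hU.finrank_ne_zero, one_smul]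
  rfl

/-- The projection of `e v ⊗ |e i⟩⟨e j|` to the image of the idempotent. -/
noncomputable def unitElt (U : L → (H →ₗ[ℂ] H))
    (p : V × Fin (Module.finrank ℂ H) × Fin (Module.finrank ℂ H)) :
    InducedSpace φ U :=
  ⟨bentIdempotent φ U (OpFun.single p.1
    (ketBra (stdOrthonormalBasis ℂ H p.2.1) (stdOrthonormalBasis ℂ H p.2.2))), ⟨_, rfl⟩⟩

noncomputable def unitElt' (U : L → (H →ₗ[ℂ] H))
    (p : V × Fin (Module.finrank ℂ H) × Fin (Module.finrank ℂ H)) :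
    InducedSpace φ U := unitElt φ U (p.1, p.2.2, p.2.1)

theorem inner_unitElt (hU : IsNiceUEB ψ U) (a : InducedSpace φ U)
    (p : V × Fin (Module.finrank ℂ H) × Fin (Module.finrank ℂ H)) :
    inner ℂ a (unitElt φ U p) = inner ℂ (stdOrthonormalBasis ℂ H p.2.2)
      (LinearMap.adjoint ((a : OpFun V H) p.1) (stdOrthonormalBasis ℂ H p.2.1)) := by
  classical
  have : inner ℂ a (unitElt φ U p) = inner ℂ (a : OpFun V H) (unitElt φ U p : OpFun V H) := rfl
  rw [this, unitElt, inner_bentIdempotent φ hU _ _ a.2, OpFun.inner_def,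
    Finset.sum_eq_single p.1]
  · rw [OpFun.single_self, trace_mul_ketBra]
  · intro v _ hv
    rw [OpFun.single_ne hv, mul_zero, map_zero]
  · simp

/-- The involution on the image of the idempotent. -/
noncomputable def inducedStar (hU : IsNiceUEB ψ U) (a : InducedSpace φ U) : InducedSpace φ U :=
  ⟨(a : OpFun V H).adjoint, by
    rw [mem_inducedSpace φ hU]
    intro g w
    rw [OpFun.adjoint_apply, OpFun.adjoint_apply, (mem_inducedSpace φ hU _).1 a.2]
    simp only [Module.End.mul_eq_comp, LinearMap.adjoint_comp, LinearMap.adjoint_adjoint,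
      LinearMap.comp_assoc]⟩

theorem inducedStar_apply (hU : IsNiceUEB ψ U) (a : InducedSpace φ U) (v : V) :
    (inducedStar φ hU a : OpFun V H) v = LinearMap.adjoint ((a : OpFun V H) v) := rfl

theorem inner_induced (a b : InducedSpace φ U) : (inner ℂ a b : ℂ) =
    ∑ v, LinearMap.trace ℂ H (LinearMap.adjoint ((a : OpFun V H) v) * (b : OpFun V H) v) := rfl

open Classical in
theorem sum_unitElt (hU : IsNiceUEB ψ U) (u w : V) :
    ∑ p, (unitElt φ U p : OpFun V H) u * (unitElt' φ U p : OpFun V H) w =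
      if u = w then (Module.finrank ℂ H : ℂ)⁻¹ • (1 : H →ₗ[ℂ] H) else 0 := by
  have h1 : ∀ v i j, (unitElt φ U (v, i, j) : OpFun V H) u = (1 / (Fintype.card L : ℂ)) •
      ∑ a : L, if φ a⁻¹ u = v then U a * ketBra (stdOrthonormalBasis ℂ H i)
        (stdOrthonormalBasis ℂ H j) * LinearMap.adjoint (U a) else 0 := fun v i j => by
    refine (bentIdempotent_apply φ hU _ u).trans ?_
    congr 1
    refine Finset.sum_congr rfl fun a _ => ?_
    by_cases h : φ a⁻¹ u = v
    · rw [if_pos h, ← h, OpFun.single_self]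
    · rw [if_neg h, OpFun.single_ne h, mul_zero, zero_mul]
  have h2 : ∀ v i j, (unitElt' φ U (v, i, j) : OpFun V H) w = (1 / (Fintype.card L : ℂ)) •
      ∑ a : L, if φ a⁻¹ w = v then U a * ketBra (stdOrthonormalBasis ℂ H j)
        (stdOrthonormalBasis ℂ H i) * LinearMap.adjoint (U a) else 0 := fun v i j => by
    refine (bentIdempotent_apply φ hU _ w).trans ?_
    congr 1
    refine Finset.sum_congr rfl fun a _ => ?_
    by_cases h : φ a⁻¹ w = v
    · rw [if_pos h, ← h, OpFun.single_self]
    · rw [if_neg h, OpFun.single_ne h, mul_zero, zero_mul]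
  have h3 : ∀ a b : L, ∑ i, ∑ j, (U a * ketBra (stdOrthonormalBasis ℂ H i)
        (stdOrthonormalBasis ℂ H j) * LinearMap.adjoint (U a)) *
      (U b * ketBra (stdOrthonormalBasis ℂ H j) (stdOrthonormalBasis ℂ H i) *
        LinearMap.adjoint (U b)) =
      if a = b then (Module.finrank ℂ H : ℂ) • (1 : H →ₗ[ℂ] H) else 0 := fun a b => by
    have : ∀ i j, (U a * ketBra (stdOrthonormalBasis ℂ H i)
        (stdOrthonormalBasis ℂ H j) * LinearMap.adjoint (U a)) *
      (U b * ketBra (stdOrthonormalBasis ℂ H j) (stdOrthonormalBasis ℂ H i) *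
        LinearMap.adjoint (U b)) = U a * (ketBra (stdOrthonormalBasis ℂ H i)
        (stdOrthonormalBasis ℂ H j) * (LinearMap.adjoint (U a) * U b) *
        ketBra (stdOrthonormalBasis ℂ H j) (stdOrthonormalBasis ℂ H i)) *
        LinearMap.adjoint (U b) := fun i j => by simp only [mul_assoc]
    simp only [this, ← Finset.mul_sum, ← Finset.sum_mul, sum_ketBra_mul, hU.trace_eq]
    split_ifs with hab
    · rw [hab, mul_smul_comm, smul_mul_assoc, mul_one, (hU.unitary b).2]
    · simp
  have hne := hU.finrank_ne_zero
  simp only [Fintype.sum_prod_type, h1, h2, smul_mul_smul_comm, ← Finset.smul_sum,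
    Finset.sum_mul_sum]
  have h4 : ∀ v, ∑ i, ∑ j, ∑ a : L, ∑ b : L,
      (if φ a⁻¹ u = v then U a * ketBra (stdOrthonormalBasis ℂ H i)
        (stdOrthonormalBasis ℂ H j) * LinearMap.adjoint (U a) else 0) *
      (if φ b⁻¹ w = v then U b * ketBra (stdOrthonormalBasis ℂ H j)
        (stdOrthonormalBasis ℂ H i) * LinearMap.adjoint (U b) else 0) =
      ∑ a : L, if φ a⁻¹ u = v then (if u = w then
        (Module.finrank ℂ H : ℂ) • (1 : H →ₗ[ℂ] H) else 0) else 0 := fun v => by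
    have e1 : ∀ i : Fin (Module.finrank ℂ H), ∀ F : Fin (Module.finrank ℂ H) → L → L → (H →ₗ[ℂ] H),
      ∑ j, ∑ a : L, ∑ b : L, F j a b = ∑ a : L, ∑ b : L, ∑ j, F j a b := fun i F => by
        rw [Finset.sum_comm]
        exact Finset.sum_congr rfl fun a _ => Finset.sum_comm
    simp only [e1 ⟨0, Nat.pos_of_ne_zero (by exact_mod_cast hne)⟩]
    refine Finset.sum_congr rfl fun a _ => ?_
    rw [Finset.sum_eq_single a]
    · have hinj : φ a⁻¹ w = φ a⁻¹ u ↔ u = w := by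
        rw [(φ a⁻¹).injective.eq_iff, eq_comm]
      by_cases hu : φ a⁻¹ u = v
      · by_cases huw : u = w
        · subst huw
          simp only [if_pos hu, if_true, h3]
        · have : φ a⁻¹ w ≠ v := fun h => huw (hinj.1 (h.trans hu.symm))
          simp only [if_neg this, if_neg huw, mul_zero, Finset.sum_const_zero, ite_self]
      · simp only [if_neg hu, zero_mul, Finset.sum_const_zero]
    · intro b _ hb
      by_cases hu : φ a⁻¹ u = v
      · by_cases hw : φ b⁻¹ w = v
        · simp only [if_pos hu, if_pos hw, h3, if_neg (Ne.symm hb)]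
        · simp only [if_neg hw, mul_zero, Finset.sum_const_zero]
      · simp only [if_neg hu, zero_mul, Finset.sum_const_zero]
    · simp
  simp only [h4]
  rw [Finset.sum_comm]
  simp only [Finset.sum_ite_eq, Finset.mem_univ, if_true, Finset.sum_const, Finset.card_univ]
  split_ifs with huw
  · rw [← Nat.cast_smul_eq_nsmul ℂ, smul_smul, smul_smul, hU.card_eq']
    congr 1
    field_simp
  · simp

theorem induced_criterion (hU : IsNiceUEB ψ U) : FrobCriterion (inducedMul φ U) (inducedUnit φ U)
    (unitElt φ U) (unitElt' φ U) (inducedStar φ hU) where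
  assoc a b c := by
    ext1; funext v
    simp only [inducedMul_apply φ hU, smul_mul_assoc, mul_smul_comm, mul_assoc]
  one_mul a := by
    ext1; funext v
    rw [inducedMul_apply φ hU, inducedUnit_apply φ hU, smul_mul_assoc, one_mul, smul_smul,
      mul_inv_cancel₀ hU.sqrt_finrank_ne_zero, one_smul]
  mul_one a := by
    ext1; funext v
    rw [inducedMul_apply φ hU, inducedUnit_apply φ hU, mul_smul_comm, mul_one, smul_smul,
      mul_inv_cancel₀ hU.sqrt_finrank_ne_zero, one_smul]
  inner_mul a b c := by
    simp only [inner_induced, inducedMul_apply φ hU, inducedStar_apply]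
    refine Finset.sum_congr rfl fun v _ => ?_
    rw [map_smulₛₗ, Complex.conj_ofReal, smul_mul_assoc, mul_smul_comm, map_smul, map_smul,
      Module.End.mul_eq_comp, Module.End.mul_eq_comp, LinearMap.adjoint_comp,
      LinearMap.comp_assoc, ← Module.End.mul_eq_comp, LinearMap.trace_mul_comm]
    rfl
  casimir a b c := by
    have h1 : ∀ p, (inner ℂ a (inducedMul φ U (c ⊗ₜ unitElt φ U p)) : ℂ) =
        inner ℂ (inducedMul φ U (inducedStar φ hU c ⊗ₜ a)) (unitElt φ U p) := fun p => by
      simp only [inner_induced, inducedMul_apply φ hU, inducedStar_apply]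
      refine Finset.sum_congr rfl fun v _ => ?_
      rw [map_smulₛₗ, Complex.conj_ofReal, smul_mul_assoc, mul_smul_comm, Module.End.mul_eq_comp,
        Module.End.mul_eq_comp, Module.End.mul_eq_comp, Module.End.mul_eq_comp,
        LinearMap.adjoint_comp, LinearMap.adjoint_adjoint, LinearMap.comp_assoc]
    simp only [h1, unitElt', inner_unitElt φ hU, Fintype.sum_prod_type]
    simp only [sum_inner_mul_inner, inner_induced]
    refine Finset.sum_congr rfl fun v _ => ?_
    simp only [inducedMul_apply φ hU, inducedStar_apply, map_smulₛₗ, Complex.conj_ofReal,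
      smul_mul_assoc, RingHom.id_apply]
    congr 1
    rw [LinearMap.trace_mul_comm, Module.End.mul_eq_comp, Module.End.mul_eq_comp,
      LinearMap.adjoint_comp, LinearMap.adjoint_adjoint, Module.End.mul_eq_comp,
      Module.End.mul_eq_comp, LinearMap.adjoint_comp, LinearMap.comp_assoc]
  sum_mul := by
    ext1; funext v
    have : ((∑ p, inducedMul φ U (unitElt φ U p ⊗ₜ unitElt' φ U p) : InducedSpace φ U) :
        OpFun V H) v = ∑ p, (inducedMul φ U (unitElt φ U p ⊗ₜ unitElt' φ U p) : OpFun V H) v := by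
      rw [Submodule.coe_sum]
      exact Finset.sum_apply v _ _
    rw [this]
    simp only [inducedMul_apply φ hU, ← Finset.smul_sum]
    rw [sum_unitElt φ hU, if_pos rfl, smul_smul, inducedUnit_apply φ hU, ← sqrt_finrank_sq]
    congr 1
    have := hU.sqrt_finrank_ne_zero
    field_simp
  symm a b := by
    simp only [inner_induced, inducedMul_apply φ hU, inducedUnit_apply φ hU]
    refine Finset.sum_congr rfl fun v _ => ?_
    rw [map_smulₛₗ, Module.End.one_eq_id, LinearMap.adjoint_id, ← Module.End.one_eq_id]
    simp only [smul_mul_assoc, one_mul, map_smul]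
    rw [LinearMap.trace_mul_comm]

theorem induced_sum_apply {ι : Type*} [Fintype ι] (f : ι → InducedSpace φ U) (v : V) :
    ((∑ p, f p : InducedSpace φ U) : OpFun V H) v = ∑ p, (f p : OpFun V H) v := by
  rw [Submodule.coe_sum]
  exact Finset.sum_apply v _ _

open Classical in
theorem sum_entries_aux {ι A : Type*} [Fintype ι] [Ring A] [Algebra ℂ A] (s n : ℂ) (hs : s ^ 2 = n)
    (hn : n ≠ 0) (x y : ι → V → A)
    (hxy : ∀ u w, ∑ p, x p u * y p w = if u = w then n⁻¹ • (1 : A) else 0)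
    (c : V → A) (e f : V → ℂ) :
    ∑ p, s • ((∑ w, e w • (s • (c w * x p w))) * ∑ w, f w • y p w) =
      ∑ w, (e w * f w) • c w := by
  have h : ∀ p, s • ((∑ w, e w • (s • (c w * x p w))) * ∑ w, f w • y p w) =
      ∑ u, ∑ w, (n * (e u * f w)) • (c u * (x p u * y p w)) := fun p => by
    rw [Finset.sum_mul_sum, Finset.smul_sum]
    refine Finset.sum_congr rfl fun u _ => ?_
    rw [Finset.smul_sum]
    refine Finset.sum_congr rfl fun w _ => ?_
    rw [smul_smul, smul_mul_smul_comm, smul_smul, mul_assoc (c u), ← hs]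
    congr 1
    ring
  simp only [h]
  rw [Finset.sum_comm]
  refine Finset.sum_congr rfl fun u _ => ?_
  rw [Finset.sum_comm]
  simp only [← Finset.smul_sum, ← Finset.mul_sum, hxy]
  rw [Finset.sum_eq_single u]
  · rw [if_pos rfl, mul_smul_comm, mul_one, smul_smul]
    congr 1
    field_simp
  · intro w _ hw
    rw [if_neg (Ne.symm hw), mul_zero, smul_zero]
  · simp

theorem sum_entries (hU : IsNiceUEB ψ U) (c : InducedSpace φ U) (e f : V → ℂ) :
    ∑ p, ((√(Module.finrank ℂ H : ℝ) : ℝ) : ℂ) •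
      ((∑ w, e w • (((√(Module.finrank ℂ H : ℝ) : ℝ) : ℂ) •
        ((c : OpFun V H) w * (unitElt φ U p : OpFun V H) w))) *
        ∑ w, f w • (unitElt' φ U p : OpFun V H) w) =
      ∑ w, (e w * f w) • (c : OpFun V H) w :=
  sum_entries_aux (A := H →ₗ[ℂ] H) _ _ sqrt_finrank_sq hU.finrank_ne_zero
    (fun p w => (unitElt φ U p : OpFun V H) w) (fun p w => (unitElt' φ U p : OpFun V H) w)
    (sum_unitElt φ hU) (fun w => (c : OpFun V H) w) e f

theorem inner_inducedAdj (hU : IsNiceUEB ψ U) (a b : InducedSpace φ U) :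
    (inner ℂ (inducedAdj φ U a) b : ℂ) = inner ℂ a (inducedAdj φ U b) := by
  simp only [inner_induced, inducedAdj_apply φ hU, map_sum, map_smulₛₗ, adjEntry_conj,
    Finset.mul_sum, Finset.sum_mul, smul_mul_assoc, mul_smul_comm, RingHom.id_apply]
  rw [Finset.sum_comm]
  refine Finset.sum_congr rfl fun v _ => Finset.sum_congr rfl fun w _ => ?_
  rw [adjEntry_comm]

theorem inducedAdj_schur (hU : IsNiceUEB ψ U) (c : InducedSpace φ U) :
    ∑ p, inducedMul φ U (inducedAdj φ U (inducedMul φ U (c ⊗ₜ unitElt φ U p)) ⊗ₜ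
      inducedAdj φ U (unitElt' φ U p)) = inducedAdj φ U c := by
  ext1; funext v
  rw [induced_sum_apply, inducedAdj_apply φ hU]
  simp only [inducedMul_apply φ hU, inducedAdj_apply φ hU]
  rw [sum_entries φ hU]
  refine Finset.sum_congr rfl fun w _ => ?_
  rw [adjEntry_mul_self]

theorem inner_one_mul (hU : IsNiceUEB ψ U) (a b : InducedSpace φ U) :
    (inner ℂ (inducedUnit φ U 1) (inducedMul φ U (a ⊗ₜ b)) : ℂ) =
      ∑ v, LinearMap.trace ℂ H ((a : OpFun V H) v * (b : OpFun V H) v) := by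
  rw [inner_induced]
  refine Finset.sum_congr rfl fun v _ => ?_
  rw [inducedMul_apply φ hU, inducedUnit_apply φ hU, map_smulₛₗ, Module.End.one_eq_id,
    LinearMap.adjoint_id, ← Module.End.one_eq_id, map_inv₀, Complex.conj_ofReal,
    smul_mul_smul_comm, inv_mul_cancel₀ hU.sqrt_finrank_ne_zero, one_smul, one_mul]

theorem inducedAdj_transpose (hU : IsNiceUEB ψ U) (a b : InducedSpace φ U) :
    (inner ℂ (inducedUnit φ U 1) (inducedMul φ U (inducedAdj φ U a ⊗ₜ b)) : ℂ) =
      inner ℂ (inducedUnit φ U 1) (inducedMul φ U (a ⊗ₜ inducedAdj φ U b)) := by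
  rw [inner_one_mul φ hU, inner_one_mul φ hU]
  simp only [inducedAdj_apply φ hU, Finset.mul_sum, Finset.sum_mul, smul_mul_assoc,
    mul_smul_comm, map_sum, map_smul]
  rw [Finset.sum_comm]
  refine Finset.sum_congr rfl fun v _ => Finset.sum_congr rfl fun w _ => ?_
  rw [adjEntry_comm]

theorem inducedAdj_reflexive (hU : IsNiceUEB ψ U) (c : InducedSpace φ U) :
    ∑ p, inducedMul φ U (inducedAdj φ U (inducedMul φ U (c ⊗ₜ unitElt φ U p)) ⊗ₜ
      unitElt' φ U p) = c := by
  classical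
  ext1; funext v
  have hs : ∀ F : OpFun V H, F v = ∑ w, (if v = w then (1 : ℂ) else 0) • F w := fun F => by
    rw [Finset.sum_eq_single v]
    · rw [if_pos rfl, one_smul]
    · intro w _ hw
      rw [if_neg (Ne.symm hw), zero_smul]
    · simp
  rw [induced_sum_apply]
  simp only [inducedMul_apply φ hU, inducedAdj_apply φ hU]
  have h1 : ∀ p, (unitElt' φ U p : OpFun V H) v = _ := fun p => hs _
  simp only [h1]
  rw [sum_entries φ hU, Finset.sum_eq_single v]
  · rw [if_pos rfl, adjEntry_self, one_mul, one_smul]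
  · intro w _ hw
    rw [if_neg (Ne.symm hw), mul_zero, zero_smul]
  · simp

end Facts

/-- The quantum graph `Γ_{L,ψ}`, for the action `φ` of `L` on the classical graph `Γ = G`. -/
noncomputable def inducedGraph (U : L → (H →ₗ[ℂ] H)) (hU : IsNiceUEB ψ U) : QuantumGraph :=
  (induced_criterion φ hU).toQuantumGraph (inducedAdj φ U) (inner_inducedAdj φ hU)
    (inducedAdj_schur φ hU) (inducedAdj_transpose φ hU) (inducedAdj_reflexive φ hU)

end Induced

/-! ### Linear binary constraint systems -/

/-- A linear binary constraint system with `m` variables and `p` constraints: the `l`-th constraint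
is the equation `∏ i ∈ S l, x i = b l`. -/
structure LinearBCS (m p : ℕ) where
  S : Fin p → Finset (Fin m)
  b : Fin p → ℤˣ

namespace LinearBCS

variable {m p : ℕ} (F : LinearBCS m p)

/-- The homogenisation: all right hand sides are set to `+1`. -/
def homogenisation : LinearBCS m p where
  S := F.S
  b _ := 1

/-- The local classical solutions of the `l`-th constraint. -/
def LocalSolution (l : Fin p) : Type := {f : F.S l → ℤˣ // ∏ i, f i = F.b l}

/-- The vertices of the graph of `F`: a constraint together with a local solution of it. -/
def Vertex : Type := Σ l, F.LocalSolution l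

noncomputable instance (l : Fin p) : Fintype (F.LocalSolution l) :=
  inferInstanceAs (Fintype {f : F.S l → ℤˣ // ∏ i, f i = F.b l})

noncomputable instance : Fintype F.Vertex := inferInstanceAs (Fintype (Σ l, F.LocalSolution l))

/-- The graph of `F`: two vertices are adjacent if and only if the local solutions differ on some
variable which occurs in both constraints. -/
def graph : SimpleGraph F.Vertex where
  Adj v w := ∃ (i : Fin m) (hv : i ∈ F.S v.1) (hw : i ∈ F.S w.1), v.2.1 ⟨i, hv⟩ ≠ w.2.1 ⟨i, hw⟩
  symm := ⟨fun _ _ ⟨i, hv, hw, h⟩ => ⟨i, hw, hv, h.symm⟩⟩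
  loopless := ⟨fun _ ⟨_, _, _, h⟩ => h rfl⟩

/-- A quantum solution of `F` on the finite-dimensional Hilbert space `H`. -/
structure IsQuantumSolution {H : Type*} [NormedAddCommGroup H] [InnerProductSpace ℂ H]
    [FiniteDimensional ℂ H] (X : Fin m → (H →ₗ[ℂ] H)) : Prop where
  selfAdjoint : ∀ i, LinearMap.adjoint (X i) = X i
  eigenvalue : ∀ i (c : ℂ), Module.End.HasEigenvalue (X i) c → c = 1 ∨ c = -1
  commute : ∀ l, ∀ i ∈ F.S l, ∀ j ∈ F.S l, Commute (X i) (X j)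
  constraint : ∀ l, (F.S l).noncommProd X (fun i hi j hj _ => commute l i hi j hj) =
    ((F.b l : ℤ) : ℂ) • (1 : H →ₗ[ℂ] H)

end LinearBCS

/-! Conjugation by `U a` multiplies each `X i` by a sign `s a i`. Conjugation is an action, so `s`
is multiplicative in `a`; it carries joint spectral projections of a constraint to joint spectral
projections, so `s a` solves the homogenised system (`LinearBCS.IsQuantumSolution.prod_eq_one`).
Hence `L` acts on the graph of the homogenisation by multiplying local solutions by `s a`. If `a`
acts trivially, then `s a = 1`, because every variable occurs in a constraint; so `U a` commutes
with all `X i` and is scalar by irreducibility, and trace orthogonality to the scalar `U 1` forces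
`a = 1`.

For another nice error basis `W`, products and adjoints of basis elements are dictated by `ψ`, so `U
a ↦ W a` extends to a `*`-homomorphism (`IsNiceUEB.exists_algHom`). It carries `X` to a quantum
solution `Y` on `K` with the same signs `s a i` under conjugation by `W a`.

Let `P l f` be the joint spectral projections of the `Y i` in the `l`-th constraint; they vanish
unless `f` solves it. The matrix with entry `P l (f g)` at the vertices `(l, f)` and `(l, g)`, and
zero at vertices with different constraints, is a quantum isomorphism between the two graphs
(`LinearBCS.isQuantumIso_entry`), equivariant for `L` (`LinearBCS.entry_flip`). Its matrix `E` gives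
the map sending `x` to the function `w ↦ n^(-1/2) ∑ v, x v • E v w`, an inner product preserving
homomorphism of quantum graphs from `ℂ^V` into the equivariant functions
(`IsQuantumIso.nonempty_iso`). It is onto by a dimension count: the dimension of such a Frobenius
algebra is the squared norm of its unit (`FrobCriterion.finrank_eq`). -/

section CriterionIso

/-! ### Dimension and isomorphisms of Frobenius algebras -/

variable {A ι : Type*} [NormedAddCommGroup A] [InnerProductSpace ℂ A] [FiniteDimensional ℂ A]
  [Fintype ι]
  {mul : A ⊗[ℂ] A →ₗ[ℂ] A} {unit : ℂ →ₗ[ℂ] A} {x y : ι → A} {s : A → A}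

/-- The dimension of a special symmetric dagger Frobenius algebra is the squared norm of its
unit. -/
theorem FrobCriterion.finrank_eq (h : FrobCriterion mul unit x y s) :
    (Module.finrank ℂ A : ℂ) = inner ℂ (unit 1) (unit 1) := by
  set b := stdOrthonormalBasis ℂ A
  -- The dimension is computed as the trace of the identity, with the identity written in the dual
  -- families `x`, `y` by the snake identity.
  have h1 : ∀ k, (1 : ℂ) = ∑ i, inner ℂ (unit 1) (mul (y i ⊗ₜ b k)) * inner ℂ (b k) (x i) :=
    fun k => by
      have h2 : inner ℂ (b k) (b k) = (1 : ℂ) := by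
        rw [inner_self_eq_norm_sq_to_K, b.norm_eq_one]; simp
      refine h2.symm.trans ?_
      conv_lhs => rw [← h.snake (b k)]
      rw [inner_sum]
      simp only [inner_smul_right, h.snake (b k)]
  -- Summing over the orthonormal basis reassembles `x i`; symmetry of the form puts the factors in
  -- the order needed for `∑ i, x i * y i = 1`.
  have h3 : ∀ i, ∑ k, inner ℂ (unit 1) (mul (y i ⊗ₜ b k)) * inner ℂ (b k) (x i) =
      inner ℂ (unit 1) (mul (x i ⊗ₜ y i)) := fun i => by
    rw [h.symm]
    conv_rhs => rw [← b.sum_repr' (x i)]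
    simp only [TensorProduct.tmul_sum, TensorProduct.tmul_smul, map_sum, map_smul, inner_sum,
      inner_smul_right]
    exact Finset.sum_congr rfl fun k _ => mul_comm _ _
  calc (Module.finrank ℂ A : ℂ) = ∑ _k : Fin (Module.finrank ℂ A), (1 : ℂ) := by simp
    _ = ∑ k, ∑ i, inner ℂ (unit 1) (mul (y i ⊗ₜ b k)) * inner ℂ (b k) (x i) :=
        Finset.sum_congr rfl fun k _ => h1 k
    _ = _ := by
        rw [Finset.sum_comm]
        simp only [h3, ← inner_sum, h.sum_mul]

/-- The unit has comultiplication `∑ i, x i ⊗ y i`, and the Casimir identity with `c = 1` moves `a`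
across the inner product, where it becomes `s a`. Thus compatibility with the canonical involution
can be checked on the explicit one. -/
theorem FrobCriterion.star_eq (h : FrobCriterion mul unit x y s) (a : A) :
    h.toFrobAlg.star a = s a := by
  have h1 : h.toFrobAlg.star a = ∑ i, inner ℂ a (y i) • x i := by
    simp [FrobAlg.star, FrobAlg.comul, h.adjoint_apply, h.one_mul]
  rw [h1]
  refine ext_inner_left ℂ fun p => ?_
  have h2 := h.casimir p a (unit 1)
  rw [h.inner_mul] at h2
  simp only [h.one_mul] at h2
  rw [← h2, inner_sum]
  simp only [inner_smul_right, mul_comm]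

variable {B κ : Type*} [NormedAddCommGroup B] [InnerProductSpace ℂ B] [FiniteDimensional ℂ B]
  [Fintype κ]
  {mul' : B ⊗[ℂ] B →ₗ[ℂ] B} {unit' : ℂ →ₗ[ℂ] B} {x' y' : κ → B} {s' : B → B}

/-- An inner product preserving homomorphism of quantum graphs is an isomorphism: the dimensions
agree, as the units have the same norm. -/
theorem FrobCriterion.nonempty_iso (h : FrobCriterion mul unit x y s)
    (h' : FrobCriterion mul' unit' x' y' s')
    {adj : A →ₗ[ℂ] A} {hsa : ∀ a b, inner ℂ (adj a) b = inner ℂ a (adj b)}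
    {hschur : ∀ c, ∑ i, mul (adj (mul (c ⊗ₜ x i)) ⊗ₜ adj (y i)) = adj c}
    {htrans : ∀ a b, inner ℂ (unit 1) (mul (adj a ⊗ₜ b)) = inner ℂ (unit 1) (mul (a ⊗ₜ adj b))}
    {hrefl : ∀ c, ∑ i, mul (adj (mul (c ⊗ₜ x i)) ⊗ₜ y i) = c}
    {adj' : B →ₗ[ℂ] B} {hsa' : ∀ a b, inner ℂ (adj' a) b = inner ℂ a (adj' b)}
    {hschur' : ∀ c, ∑ i, mul' (adj' (mul' (c ⊗ₜ x' i)) ⊗ₜ adj' (y' i)) = adj' c}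
    {htrans' : ∀ a b, inner ℂ (unit' 1) (mul' (adj' a ⊗ₜ b)) =
      inner ℂ (unit' 1) (mul' (a ⊗ₜ adj' b))}
    {hrefl' : ∀ c, ∑ i, mul' (adj' (mul' (c ⊗ₜ x' i)) ⊗ₜ y' i) = c}
    (Φ : A →ₗ[ℂ] B) (hmul : ∀ a b, Φ (mul (a ⊗ₜ b)) = mul' (Φ a ⊗ₜ Φ b))
    (hunit : Φ (unit 1) = unit' 1) (hinner : ∀ a b, inner ℂ (Φ a) (Φ b) = inner ℂ a b)
    (hstar : ∀ a, Φ (s a) = s' (Φ a)) (hadj : ∀ a, Φ (adj a) = adj' (Φ a)) :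
    Nonempty (QuantumGraph.Iso (h.toQuantumGraph adj hsa hschur htrans hrefl)
      (h'.toQuantumGraph adj' hsa' hschur' htrans' hrefl')) := by
  have hdim : Module.finrank ℂ A = Module.finrank ℂ B := by
    have : (Module.finrank ℂ A : ℂ) = Module.finrank ℂ B := by
      rw [h.finrank_eq, h'.finrank_eq, ← hunit, hinner]
    exact_mod_cast this
  refine ⟨{
    toIsometryEquiv := (Φ.isometryOfInner hinner).toLinearIsometryEquiv hdim
    map_mul := hmul
    map_unit := fun c => ?_
    map_star := fun a => ?_
    map_adj := hadj }⟩
  · change Φ (unit c) = unit' c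
    have h1 : unit c = c • unit 1 := by rw [← map_smul]; simp
    have h2 : unit' c = c • unit' 1 := by rw [← map_smul]; simp
    rw [h1, h2, map_smul, hunit]
  · change Φ (h.toFrobAlg.star a) = h'.toFrobAlg.star (Φ a)
    rw [h.star_eq, h'.star_eq, hstar]

end CriterionIso

/-! ### Equivariant quantum isomorphisms -/

section MagicUnitary

variable {V V' L K : Type*} [Fintype V] [Fintype V'] [Group L] [Fintype L]
  [NormedAddCommGroup K] [InnerProductSpace ℂ K] [FiniteDimensional ℂ K]

/-- A quantum isomorphism between classical graphs: a matrix of orthogonal projections whose rows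
and columns sum to the identity, and which intertwines the adjacency matrices. -/
structure IsQuantumIso (G : SimpleGraph V) (G' : SimpleGraph V') (E : V → V' → (K →ₗ[ℂ] K)) :
    Prop where
  selfAdjoint : ∀ v w, LinearMap.adjoint (E v w) = E v w
  orthogonal : ∀ v v' w, v ≠ v' → E v w * E v' w = 0
  sum_left : ∀ w, ∑ v, E v w = 1
  sum_right : ∀ v, ∑ w, E v w = 1
  adj : ∀ v w, ∑ w', adjEntry G' w w' • E v w' = ∑ v', adjEntry G v v' • E v' w

variable {G : SimpleGraph V} {G' : SimpleGraph V'} {E : V → V' → (K →ₗ[ℂ] K)}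

namespace IsQuantumIso

/-- Multiply `E v w` by the column sum `1`; orthogonality leaves only the diagonal term. -/
theorem idempotent (hE : IsQuantumIso G G' E) (v : V) (w : V') : E v w * E v w = E v w := by
  conv_rhs => rw [← mul_one (E v w), ← hE.sum_left w, Finset.mul_sum]
  rw [Finset.sum_eq_single v (fun v' _ hv => hE.orthogonal v v' w hv.symm) (by simp)]

/-- Each column is a family of orthogonal idempotents, so it represents the algebra `ℂ^V`
multiplicatively. -/
theorem sum_mul_sum (hE : IsQuantumIso G G' E) (x y : V → ℂ) (w : V') :
    (∑ v, x v • E v w) * ∑ v, y v • E v w = ∑ v, (x v * y v) • E v w := by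
  rw [Finset.sum_mul_sum]
  refine Finset.sum_congr rfl fun v _ => ?_
  rw [Finset.sum_eq_single v]
  · rw [smul_mul_smul_comm, hE.idempotent]
  · intro v' _ hv
    rw [smul_mul_smul_comm, hE.orthogonal v v' w hv.symm, smul_zero]
  · simp

theorem adjoint_sum (hE : IsQuantumIso G G' E) (x : V → ℂ) (w : V') :
    LinearMap.adjoint (∑ v, x v • E v w) = ∑ v, (starRingEnd ℂ) (x v) • E v w := by
  simp only [map_sum, map_smulₛₗ, hE.selfAdjoint]

variable (φ : L →* (G' ≃g G')) {ψ : L → L → Circle} {W : L → (K →ₗ[ℂ] K)}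

/-- The map from `ℂ^V` to the induced space which is given by an equivariant quantum
isomorphism. -/
noncomputable def inducedMap (hW : IsNiceUEB ψ W)
    (heq : ∀ a v w, E v (φ a w) = W a * E v w * LinearMap.adjoint (W a)) :
    EuclideanSpace ℂ V →ₗ[ℂ] InducedSpace φ W where
  -- With `n = dim K`, the factor `n^(-1/2)` matches the product `√n F F'` and the unit `n^(-1/2)`,
  -- and compensates for the traces of each row of `E` summing to `n`.
  toFun x := ⟨fun w => ((√(Module.finrank ℂ K : ℝ) : ℝ) : ℂ)⁻¹ • ∑ v, x v • E v w, by
    refine (mem_inducedSpace φ hW _).2 fun a w => ?_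
    simp only [heq, mul_smul_comm, smul_mul_assoc, Finset.mul_sum, Finset.sum_mul]⟩
  map_add' x y := by
    refine Subtype.ext (funext fun w => ?_)
    change ((√(Module.finrank ℂ K : ℝ) : ℝ) : ℂ)⁻¹ • ∑ v, (x v + y v) • E v w =
      ((√(Module.finrank ℂ K : ℝ) : ℝ) : ℂ)⁻¹ • ∑ v, x v • E v w +
        ((√(Module.finrank ℂ K : ℝ) : ℝ) : ℂ)⁻¹ • ∑ v, y v • E v w
    simp only [add_smul, Finset.sum_add_distrib, smul_add]
  map_smul' r x := by
    refine Subtype.ext (funext fun w => ?_)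
    change ((√(Module.finrank ℂ K : ℝ) : ℝ) : ℂ)⁻¹ • ∑ v, (r * x v) • E v w =
      r • ((√(Module.finrank ℂ K : ℝ) : ℝ) : ℂ)⁻¹ • ∑ v, x v • E v w
    simp only [mul_smul, ← Finset.smul_sum]
    rw [smul_comm]

/-- An equivariant quantum isomorphism from `G` to `G'` yields an isomorphism from `G` to the
quantum graph induced from `G'`. -/
theorem nonempty_iso (hE : IsQuantumIso G G' E) (hW : IsNiceUEB ψ W)
    (heq : ∀ a v w, E v (φ a w) = W a * E v w * LinearMap.adjoint (W a)) :
    Nonempty (QuantumGraph.Iso (QuantumGraph.ofSimpleGraph G) (inducedGraph φ W hW)) := by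
  classical
  set c : ℂ := ((√(Module.finrank ℂ K : ℝ) : ℝ) : ℂ) with hc
  have hc0 : c ≠ 0 := hW.sqrt_finrank_ne_zero
  have hcc : (starRingEnd ℂ) c⁻¹ = c⁻¹ := by rw [map_inv₀, hc, Complex.conj_ofReal]
  have hcn : c⁻¹ * c⁻¹ * (Module.finrank ℂ K : ℂ) = 1 := by
    rw [← sqrt_finrank_sq, ← hc]; field_simp
  let Φ := inducedMap φ hW heq
  have hΦ : ∀ x w, (Φ x : OpFun V' K) w = c⁻¹ • ∑ v, x v • E v w := fun _ _ => rfl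
  unfold QuantumGraph.ofSimpleGraph inducedGraph
  refine FrobCriterion.nonempty_iso _ _ Φ ?_ ?_ ?_ ?_ ?_
  · intro a b
    ext1; funext w
    rw [inducedMul_apply φ hW, hΦ, hΦ, hΦ, smul_mul_smul_comm, hE.sum_mul_sum, smul_smul, ← hc]
    simp only [classicalMul_tmul]
    congr 1
    field_simp
  · ext1; funext w
    rw [inducedUnit_apply φ hW, hΦ]
    simp only [classicalUnit_one, one_smul, hE.sum_left, hc]
  · intro a b
    rw [inner_induced, PiLp.inner_apply]
    have : ∀ w, LinearMap.trace ℂ K (LinearMap.adjoint ((Φ a : OpFun V' K) w) *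
        (Φ b : OpFun V' K) w) = ∑ v, c⁻¹ * c⁻¹ * ((starRingEnd ℂ) (a v) * b v) *
          LinearMap.trace ℂ K (E v w) := fun w => by
      rw [hΦ, hΦ, map_smulₛₗ, hcc, hE.adjoint_sum, smul_mul_smul_comm, hE.sum_mul_sum, map_smul,
        map_sum, Finset.smul_sum]
      simp only [map_smul, smul_eq_mul, mul_assoc]
    simp only [this]
    rw [Finset.sum_comm]
    refine Finset.sum_congr rfl fun v _ => ?_
    -- This is where the row sums matter: the traces of the entries in row `v` add up to `Tr 1 = n`,
    -- which cancels `c⁻¹ * c⁻¹`.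
    rw [← Finset.mul_sum, ← map_sum, hE.sum_right, LinearMap.trace_one, RCLike.inner_apply]
    linear_combination ((starRingEnd ℂ) (a v) * b v) * hcn
  · intro a
    ext1; funext w
    rw [inducedStar_apply, hΦ, hΦ, map_smulₛₗ, hcc, hE.adjoint_sum]
  · intro a
    ext1; funext w
    rw [inducedAdj_apply φ hW, hΦ]
    simp only [hΦ, classicalAdj_apply, smul_comm _ c⁻¹, ← Finset.smul_sum]
    congr 1
    simp only [Finset.sum_smul, Finset.smul_sum, smul_smul]
    rw [Finset.sum_comm, Finset.sum_comm (f := fun w' v => (adjEntry G' w w' * a v) • E v w')]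
    refine Finset.sum_congr rfl fun v _ => ?_
    simp only [mul_comm _ (a v), mul_smul, ← Finset.smul_sum]
    rw [hE.adj]
    simp only [adjEntry_comm G v]

end IsQuantumIso

end MagicUnitary

/-! ### Joint spectral resolutions of commuting involutions -/

section Involutions

/-- Sign identities are obtained from this by computing one nonzero operator in two ways. -/
theorem intUnit_eq_of_smul {M : Type*} [AddCommGroup M] [Module ℂ M] {s t : ℤˣ} {x : M}
    (h : ((s : ℤ) : ℂ) • x = ((t : ℤ) : ℂ) • x) (hx : x ≠ 0) : s = t := by
  have := smul_left_injective ℂ hx h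
  exact Units.ext (by exact_mod_cast this)

theorem intUnit_cast_mul_self (s : ℤˣ) : ((s : ℤ) : ℂ) * ((s : ℤ) : ℂ) = 1 := by
  rcases Int.units_eq_one_or s with rfl | rfl <;> simp

/-- Commuting involutions have a joint spectral resolution. -/
theorem exists_resolution_of_comm {A ι : Type*} [CommRing A] [Algebra ℂ A] [Fintype ι]
    [DecidableEq ι] (y : ι → A) (hy : ∀ i, y i * y i = 1) :
    ∃ P : (ι → ℤˣ) → A, ∑ f, P f = 1 ∧ ∀ f i, y i * P f = ((f i : ℤ) : ℂ) • P f := by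
  -- The factor `(1 + f i • y i) / 2` is the projection to the eigenvalue `f i` of `y i`.
  refine ⟨fun f => ∏ i, (2⁻¹ : ℂ) • (1 + ((f i : ℤ) : ℂ) • y i), ?_, fun f i => ?_⟩
  -- The sum over all `f` is the expansion of a product over `i`, whose factors are `(1 + y i) / 2 +
  -- (1 - y i) / 2 = 1`.
  · have h := Finset.prod_univ_sum (fun _ : ι => (Finset.univ : Finset ℤˣ))
      (fun i s => (2⁻¹ : ℂ) • (1 + ((s : ℤ) : ℂ) • y i))
    rw [Fintype.piFinset_univ] at h
    rw [← h]
    refine Finset.prod_eq_one fun i _ => ?_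
    rw [UnitsInt.univ, Finset.sum_pair (by decide), ← smul_add]
    simp only [Units.val_one, Units.val_neg, Int.cast_one, Int.cast_neg, one_smul, neg_smul]
    have : (1 + y i + (1 + -y i) : A) = (2 : ℂ) • 1 := by
      rw [two_smul]; ring
    rw [this, smul_smul]; norm_num
  · beta_reduce
    -- Only the `i`-th factor is affected, and `y i * (1 + f i • y i) = f i • (1 + f i • y i)`.
    rw [← Finset.mul_prod_erase _ _ (Finset.mem_univ i), ← mul_assoc, ← smul_mul_assoc]
    congr 1
    rw [mul_smul_comm, smul_comm ((f i : ℤ) : ℂ), mul_add, mul_smul_comm, hy, mul_one,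
      smul_add ((f i : ℤ) : ℂ), smul_smul ((f i : ℤ) : ℂ), intUnit_cast_mul_self, one_smul,
      add_comm]

-- The `y i` generate a commutative subalgebra; the resolution is built there and pushed forward
-- along the inclusion.
open scoped IsMulCommutative in
theorem exists_resolution {R ι : Type*} [Ring R] [Algebra ℂ R] [Fintype ι]
    [DecidableEq ι]
    (y : ι → R) (hy : ∀ i, y i * y i = 1) (hc : ∀ i j, Commute (y i) (y j)) :
    ∃ P : (ι → ℤˣ) → R, ∑ f, P f = 1 ∧ ∀ f i, y i * P f = ((f i : ℤ) : ℂ) • P f := by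
  let B := Algebra.adjoin ℂ (Set.range y)
  have : IsMulCommutative B := Algebra.isMulCommutative_adjoin ℂ (by
    rintro _ ⟨i, rfl⟩ _ ⟨j, rfl⟩; exact hc i j)
  obtain ⟨P, h1, h2⟩ := exists_resolution_of_comm (A := B)
    (fun i => ⟨y i, Algebra.subset_adjoin ⟨i, rfl⟩⟩) (fun i => Subtype.ext (hy i))
  refine ⟨fun f => B.val (P f), ?_, fun f i => ?_⟩
  · rw [← map_sum, h1, map_one]
  · exact congrArg B.val (h2 f i)

/-- This evaluates the product in a constraint on a joint spectral projection. -/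
theorem noncommProd_mul_eq {R ι : Type*} [Ring R] [Algebra ℂ R] [DecidableEq ι] (y : ι → R)
    (c : ι → ℂ) (P : R) (s : Finset ι) (hc : (s : Set ι).Pairwise fun i j => Commute (y i) (y j))
    (h : ∀ i ∈ s, y i * P = c i • P) : s.noncommProd y hc * P = (∏ i ∈ s, c i) • P := by
  induction s using Finset.induction_on with
  | empty => simp
  | insert a s ha ih =>
    rw [Finset.noncommProd_insert_of_notMem _ _ _ _ ha, mul_assoc,
      ih _ fun i hi => h i (Finset.mem_insert_of_mem hi), mul_smul_comm,
      h a (Finset.mem_insert_self a s), Finset.prod_insert ha, smul_smul, mul_comm]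

variable {K ι : Type*} [NormedAddCommGroup K] [InnerProductSpace ℂ K] [FiniteDimensional ℂ K]
  [Fintype ι] [DecidableEq ι]

/-- `P` is the joint spectral resolution of the self-adjoint involutions `y`. -/
structure IsResolution (y : ι → (K →ₗ[ℂ] K)) (P : (ι → ℤˣ) → (K →ₗ[ℂ] K)) : Prop where
  symm : ∀ i, LinearMap.adjoint (y i) = y i
  sum_eq : ∑ f, P f = 1
  mul_eq : ∀ f i, y i * P f = ((f i : ℤ) : ℂ) • P f

namespace IsResolution

variable {y : ι → (K →ₗ[ℂ] K)} {P Q : (ι → ℤˣ) → (K →ₗ[ℂ] K)}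

theorem adjoint_mul (h : IsResolution y P) (f : ι → ℤˣ) (i : ι) :
    LinearMap.adjoint (P f) * y i = ((f i : ℤ) : ℂ) • LinearMap.adjoint (P f) := by
  have := congrArg LinearMap.adjoint (h.mul_eq f i)
  rw [map_smulₛₗ, Module.End.mul_eq_comp, LinearMap.adjoint_comp, h.symm,
    map_intCast] at this
  exact this

/-- Insert `y i` between the factors: it acts as `f i` to the left and as `g i` to the right, so a
nonzero product would give `f = g`. -/
theorem adjoint_mul_eq_zero (h : IsResolution y P) (h' : IsResolution y Q) {f g : ι → ℤˣ}
    (hfg : f ≠ g) : LinearMap.adjoint (P f) * Q g = 0 := by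
  by_contra h0
  refine hfg (funext fun i => intUnit_eq_of_smul ?_ h0)
  rw [← smul_mul_assoc, ← h.adjoint_mul, mul_assoc, h'.mul_eq, mul_smul_comm]

theorem adjoint_eq_mul (h : IsResolution y P) (h' : IsResolution y Q) (f : ι → ℤˣ) :
    LinearMap.adjoint (P f) = LinearMap.adjoint (P f) * Q f := by
  conv_lhs => rw [← mul_one (LinearMap.adjoint (P f)), ← h'.sum_eq, Finset.mul_sum]
  exact Finset.sum_eq_single f (fun g _ hg => h.adjoint_mul_eq_zero h' hg.symm) (by simp)

/-- The adjoint of `P f` equals `P f† * P f`, which is self-adjoint. Together with orthogonality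
this makes the `P f` projections, although the structure does not require it. -/
theorem selfAdjoint (h : IsResolution y P) (f : ι → ℤˣ) : LinearMap.adjoint (P f) = P f := by
  have h1 := h.adjoint_eq_mul h f
  have h2 := congrArg LinearMap.adjoint h1
  rw [Module.End.mul_eq_comp, LinearMap.adjoint_comp, LinearMap.adjoint_adjoint] at h2
  exact h1.trans h2.symm

/-- The product `P f† * Q f` equals both `P f†` and, after taking adjoints with the roles exchanged,
`Q f`. -/
theorem unique (h : IsResolution y P) (h' : IsResolution y Q) (f : ι → ℤˣ) : P f = Q f := by
  have h1 := h.adjoint_eq_mul h' f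
  have h2 := congrArg LinearMap.adjoint (h'.adjoint_eq_mul h f)
  rw [Module.End.mul_eq_comp, LinearMap.adjoint_comp, LinearMap.adjoint_adjoint] at h2
  exact (h.selfAdjoint f).symm.trans (h1.trans h2.symm)

/-- Conjugation by a unitary which flips the signs of the involutions permutes the spectral
projections. -/
theorem conj (h : IsResolution y P) {u : K →ₗ[ℂ] K} (hu : LinearMap.adjoint u * u = 1)
    (hu' : u * LinearMap.adjoint u = 1) (s : ι → ℤˣ)
    (hs : ∀ i, u * y i * LinearMap.adjoint u = ((s i : ℤ) : ℂ) • y i) (f : ι → ℤˣ) :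
    P (s * f) = u * P f * LinearMap.adjoint u := by
  have hss : ∀ f, s * (s * f) = f := fun f => by
    rw [← mul_assoc, show s * s = 1 from funext fun i => Int.units_mul_self (s i), one_mul]
  -- Conjugating by `u` and shifting the index by `s` gives another resolution of the same
  -- involutions, so uniqueness applies; it is evaluated at `s * f`, where `s * s = 1`.
  have h' : IsResolution y fun f => u * P (s * f) * LinearMap.adjoint u :=
    { symm := h.symm
      sum_eq := by
        have h1 : ∑ f, P (s * f) = ∑ f, P f := Equiv.sum_comp (Equiv.mulLeft s) P
        rw [← Finset.sum_mul, ← Finset.mul_sum, h1, h.sum_eq, mul_one, hu']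
      mul_eq := fun f i => by
        have h1 : y i * u = ((s i : ℤ) : ℂ) • (u * y i) := by
          have h2 : u * y i = ((s i : ℤ) : ℂ) • (y i * u) := by
            rw [← smul_mul_assoc, ← hs, mul_assoc, hu, mul_one]
          rw [h2, smul_smul, intUnit_cast_mul_self, one_smul]
        rw [← mul_assoc, ← mul_assoc, h1, smul_mul_assoc, mul_assoc u, h.mul_eq, mul_smul_comm,
          smul_smul, smul_mul_assoc, Pi.mul_apply, Units.val_mul, Int.cast_mul, ← mul_assoc,
          intUnit_cast_mul_self, one_mul] }
  rw [h.unique h', hss]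

end IsResolution

end Involutions

/-! ### Spectral projections of one constraint -/

namespace LinearBCS

variable {m p : ℕ} {F : LinearBCS m p}
  {K : Type*} [NormedAddCommGroup K] [InnerProductSpace ℂ K] [FiniteDimensional ℂ K]

/-- On `P f` the product of the constraint acts both as `F.b l` and as `∏ i, f i`, so `P f` vanishes
when these differ. -/
theorem exists_isResolution {Y : Fin m → (K →ₗ[ℂ] K)} (hY : F.IsQuantumSolution Y)
    (hsq : ∀ i, Y i * Y i = 1) (l : Fin p) :
    ∃ P, IsResolution (fun i : F.S l => Y i) P ∧
      ∀ f, ∏ i, f i ≠ F.b l → P f = 0 := by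
  obtain ⟨P, h1, h2⟩ := exists_resolution (fun i : F.S l => Y i) (fun i => hsq i)
    (fun i j => hY.commute l i i.2 j j.2)
  refine ⟨P, ⟨fun i => hY.selfAdjoint i, h1, h2⟩, fun f hf => ?_⟩
  by_contra h0
  refine hf (intUnit_eq_of_smul ?_ h0)
  have h3 := noncommProd_mul_eq Y
    (fun i => if hi : i ∈ F.S l then ((f ⟨i, hi⟩ : ℤ) : ℂ) else 0) (P f) (F.S l)
    (fun i hi j hj _ => hY.commute l i hi j hj) (fun i hi => by
      rw [dif_pos hi]; exact h2 f ⟨i, hi⟩)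
  rw [hY.constraint, smul_mul_assoc, one_mul] at h3
  rw [h3]
  congr 1
  refine Eq.trans ?_ (Finset.prod_coe_sort (F.S l)
    fun i => if hi : i ∈ F.S l then ((f ⟨i, hi⟩ : ℤ) : ℂ) else 0)
  simp

end LinearBCS

/-! ### Comparison of nice unitary error bases -/

section Transport

variable {L : Type*} [Group L] [Fintype L] {ψ : L → L → Circle}
  {H : Type*} [NormedAddCommGroup H] [InnerProductSpace ℂ H] [FiniteDimensional ℂ H]
  {U : L → (H →ₗ[ℂ] H)}

namespace IsNiceUEB

theorem linearIndependent (hU : IsNiceUEB ψ U) : LinearIndependent ℂ U := by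
  classical
  rw [Fintype.linearIndependent_iff]
  intro c hc a
  have h := congrArg (fun M => LinearMap.trace ℂ H (LinearMap.adjoint (U a) * M)) hc
  simp only [Finset.mul_sum, mul_smul_comm, map_sum, map_smul, hU.trace_eq, mul_zero, map_zero,
    smul_eq_mul, mul_ite, Finset.sum_ite_eq, Finset.mem_univ, if_true] at h
  exact (mul_eq_zero.1 h).resolve_right hU.finrank_ne_zero

/-- A nice unitary error basis, as a basis of the space of operators. -/
noncomputable def basis (hU : IsNiceUEB ψ U) : Module.Basis L ℂ (H →ₗ[ℂ] H) :=
  basisOfLinearIndependentOfCardEqFinrank hU.linearIndependent (by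
    rw [Module.finrank_linearMap, hU.card_eq, sq])

theorem basis_apply (hU : IsNiceUEB ψ U) (a : L) : hU.basis a = U a := by
  simp [basis]

/-- The cocycle need not be normalised, so `U 1` is only a phase times the identity: cancel one
factor in `U 1 * U 1 = ψ 1 1 • U 1`. -/
theorem map_one (hU : IsNiceUEB ψ U) : U 1 = (ψ 1 1 : ℂ) • (1 : H →ₗ[ℂ] H) := by
  have h := congrArg (LinearMap.adjoint (U 1) * ·) (hU.mul_eq 1 1)
  simpa [← mul_assoc, (hU.unitary 1).1] using h

theorem map_inv (hU : IsNiceUEB ψ U) (a : L) :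
    U a⁻¹ = ((ψ a a⁻¹ * ψ 1 1 : Circle) : ℂ) • LinearMap.adjoint (U a) := by
  have h := congrArg (LinearMap.adjoint (U a) * ·) (hU.mul_eq a a⁻¹)
  simpa [← mul_assoc, (hU.unitary a).1, hU.map_one, smul_smul] using h

/-- The coefficient depends on `ψ` alone, so adjoints look the same in every nice error basis for
`(L, ψ)`. -/
theorem adjoint_eq (hU : IsNiceUEB ψ U) (a : L) :
    LinearMap.adjoint (U a) = (((ψ a a⁻¹ * ψ 1 1 : Circle) : ℂ))⁻¹ • U a⁻¹ := by
  rw [hU.map_inv, smul_smul, inv_mul_cancel₀ (Circle.coe_ne_zero _), one_smul]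

variable {K : Type*} [NormedAddCommGroup K] [InnerProductSpace ℂ K] [FiniteDimensional ℂ K]
  {W : L → (K →ₗ[ℂ] K)}

/-- Any two nice unitary error bases for `(L, ψ)` are related by a `*`-homomorphism. -/
theorem exists_algHom (hU : IsNiceUEB ψ U) (hW : IsNiceUEB ψ W) :
    ∃ T : (H →ₗ[ℂ] H) →ₐ[ℂ] (K →ₗ[ℂ] K), (∀ a, T (U a) = W a) ∧
      ∀ M, T (LinearMap.adjoint M) = LinearMap.adjoint (T M) := by
  -- The linear extension of `U a ↦ W a` respects unit, product and adjoint because all three have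
  -- coefficients in terms of `ψ` on the basis.
  let T := hU.basis.constr ℂ W
  have hT : ∀ a, T (U a) = W a := fun a => by
    rw [← hU.basis_apply]; exact hU.basis.constr_basis ℂ W a
  have hT1 : T 1 = 1 := by
    have h := hT 1
    rw [hU.map_one, hW.map_one, map_smul] at h
    exact smul_right_injective _ (Circle.coe_ne_zero (ψ 1 1)) h
  have hTmul : ∀ M N, T (M * N) = T M * T N := fun M N => by
    rw [← hU.basis.sum_repr M, ← hU.basis.sum_repr N]
    simp only [Finset.sum_mul_sum, map_sum, map_smul, hU.basis_apply, smul_mul_smul_comm, hT,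
      hU.mul_eq, hW.mul_eq]
  refine ⟨AlgHom.ofLinearMap T hT1 hTmul, hT, fun M => ?_⟩
  change T (LinearMap.adjoint M) = LinearMap.adjoint (T M)
  rw [← hU.basis.sum_repr M]
  simp only [map_sum, map_smul, map_smulₛₗ, hU.basis_apply, hT, hU.adjoint_eq, hW.adjoint_eq]

end IsNiceUEB

/-- By the spectral theorem there is a basis of eigenvectors, and each eigenvalue squares to `1`. -/
theorem mul_self_of_eigenvalue {X : H →ₗ[ℂ] H} (hX : LinearMap.adjoint X = X)
    (h : ∀ c : ℂ, Module.End.HasEigenvalue X c → c = 1 ∨ c = -1) : X * X = 1 := by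
  have hs : X.IsSymmetric := (LinearMap.isSymmetric_iff_isSelfAdjoint X).2 hX
  refine (hs.eigenvectorBasis rfl).toBasis.ext fun i => ?_
  have h1 := hs.apply_eigenvectorBasis rfl i
  have h2 := h _ (hs.hasEigenvalue_eigenvalues rfl i)
  simp only [OrthonormalBasis.coe_toBasis, Module.End.mul_apply, Module.End.one_apply, h1,
    map_smul, smul_smul]
  rcases h2 with h2 | h2 <;> rw [h2] <;> simp

end Transport

/-! ### Transported solutions, signs of vertices and sign-flip automorphisms -/

namespace LinearBCS

variable {m p : ℕ} {F : LinearBCS m p}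

/-- A quantum solution is transported along a `*`-homomorphism. -/
theorem IsQuantumSolution.map {H K : Type*}
    [NormedAddCommGroup H] [InnerProductSpace ℂ H] [FiniteDimensional ℂ H]
    [NormedAddCommGroup K] [InnerProductSpace ℂ K] [FiniteDimensional ℂ K]
    {X : Fin m → (H →ₗ[ℂ] H)} (hX : F.IsQuantumSolution X)
    (T : (H →ₗ[ℂ] H) →ₐ[ℂ] (K →ₗ[ℂ] K))
    (hT : ∀ M, T (LinearMap.adjoint M) = LinearMap.adjoint (T M)) :
    F.IsQuantumSolution fun i => T (X i) where
  selfAdjoint i := by rw [← hT, hX.selfAdjoint]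
  eigenvalue i c hc := by
    obtain ⟨v, hv⟩ := hc.exists_hasEigenvector
    have h1 : T (X i) * T (X i) = 1 := by
      rw [← map_mul, mul_self_of_eigenvalue (hX.selfAdjoint i) (hX.eigenvalue i), _root_.map_one]
    have h2 := congrArg (fun M : K →ₗ[ℂ] K => M v) h1
    simp only [Module.End.mul_apply, hv.apply_eq_smul, map_smul, smul_smul,
      Module.End.one_apply] at h2
    have h3 : c * c = 1 := smul_left_injective ℂ hv.2 (h2.trans (one_smul ℂ v).symm)
    exact mul_self_eq_one_iff.1 h3
  commute l i hi j hj := (hX.commute l i hi j hj).map T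
  constraint l := by
    have h := congrArg T (hX.constraint l)
    rw [map_smul, _root_.map_one] at h
    exact (Finset.map_noncommProd (F.S l) X _ (T : (H →ₗ[ℂ] H) →* (K →ₗ[ℂ] K))).symm.trans h

/-- The sign of a variable at a vertex, `1` for the variables which do not occur. -/
def Vertex.sign (v : F.Vertex) (i : Fin m) : ℤˣ :=
  if h : i ∈ F.S v.1 then v.2.1 ⟨i, h⟩ else 1

theorem Vertex.sign_of_mem (v : F.Vertex) {i : Fin m} (h : i ∈ F.S v.1) :
    v.sign i = v.2.1 ⟨i, h⟩ := dif_pos h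

theorem Vertex.exists_sign_ne {v w : F.Vertex} (h : v ≠ w) (h1 : v.1 = w.1) :
    ∃ i ∈ F.S v.1, v.sign i ≠ w.sign i := by
  obtain ⟨l, f⟩ := v
  obtain ⟨k, g⟩ := w
  obtain rfl : l = k := h1
  by_contra! hc
  refine h ?_
  congr 1
  refine Subtype.ext (funext fun i => ?_)
  exact (sign_of_mem (F := F) ⟨l, f⟩ i.2).symm.trans
    ((hc i i.2).trans (sign_of_mem (F := F) ⟨l, g⟩ i.2))

theorem graph_adj_iff (v w : F.Vertex) :
    F.graph.Adj v w ↔ ∃ i ∈ F.S v.1, i ∈ F.S w.1 ∧ v.sign i ≠ w.sign i := by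
  constructor
  · rintro ⟨i, hv, hw, h⟩
    exact ⟨i, hv, hw, by rwa [v.sign_of_mem hv, w.sign_of_mem hw]⟩
  · rintro ⟨i, hv, hw, h⟩
    exact ⟨i, hv, hw, by rwa [v.sign_of_mem hv, w.sign_of_mem hw] at h⟩

/-- Distinct local solutions of one constraint differ on one of its variables and are thus adjacent,
so equality of vertices may be relaxed to equality of constraints. In this form the relation can be
compared between the two graphs. -/
theorem eq_or_adj_iff (v w : F.Vertex) : v = w ∨ F.graph.Adj v w ↔
    (v.1 = w.1 ∨ ∃ i ∈ F.S v.1, i ∈ F.S w.1 ∧ v.sign i ≠ w.sign i) := by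
  rw [graph_adj_iff]
  constructor
  · rintro (rfl | h)
    · exact Or.inl rfl
    · exact Or.inr h
  · rintro (h | h)
    · by_cases hvw : v = w
      · exact Or.inl hvw
      · obtain ⟨i, hi, hs⟩ := Vertex.exists_sign_ne hvw h
        exact Or.inr ⟨i, hi, h ▸ hi, hs⟩
    · exact Or.inr h

theorem prod_mul_sign (s : Fin m → ℤˣ) (hs : ∀ l, ∏ i ∈ F.S l, s i = 1)
    (v : F.homogenisation.Vertex) : ∏ i : F.S v.1, s i * v.2.1 i = 1 := by
  have h : ∏ i : F.S v.1, s i = 1 := (Finset.prod_coe_sort (F.S v.1) s).trans (hs v.1)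
  exact Finset.prod_mul_distrib.trans ((congrArg₂ _ h v.2.2).trans (mul_one 1))

/-- The automorphism of the graph of the homogenisation given by a solution of the
homogenisation. -/
def flip (s : Fin m → ℤˣ) (hs : ∀ l, ∏ i ∈ F.S l, s i = 1) :
    F.homogenisation.graph ≃g F.homogenisation.graph where
  toFun v := ⟨v.1, ⟨fun i => s i * v.2.1 i, prod_mul_sign s hs v⟩⟩
  invFun v := ⟨v.1, ⟨fun i => s i * v.2.1 i, prod_mul_sign s hs v⟩⟩
  left_inv v := Sigma.ext rfl (heq_of_eq (Subtype.ext (funext fun i => by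
    change s i * (s i * v.2.1 i) = v.2.1 i
    rw [← mul_assoc, Int.units_mul_self, one_mul])))
  right_inv v := Sigma.ext rfl (heq_of_eq (Subtype.ext (funext fun i => by
    change s i * (s i * v.2.1 i) = v.2.1 i
    rw [← mul_assoc, Int.units_mul_self, one_mul])))
  -- At a shared variable both values are multiplied by the same sign.
  map_rel_iff' {v w} := exists_congr fun i => exists_congr fun _ => exists_congr fun _ =>
    not_congr (mul_right_inj (s i))

theorem flip_fst (s : Fin m → ℤˣ) (hs : ∀ l, ∏ i ∈ F.S l, s i = 1) (v : F.homogenisation.Vertex) :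
    (flip s hs v).1 = v.1 := rfl

end LinearBCS

/-! ### The quantum isomorphism between a system and its homogenisation -/

namespace LinearBCS

variable {m p : ℕ} {F : LinearBCS m p}

theorem Vertex.prod_sign (v : F.Vertex) : ∏ i : F.S v.1, v.sign i = F.b v.1 := by
  rw [← v.2.2]
  exact Finset.prod_congr rfl fun i _ => v.sign_of_mem i.2

theorem flip_sign (s : Fin m → ℤˣ) (hs : ∀ l, ∏ i ∈ F.S l, s i = 1)
    (v : F.homogenisation.Vertex) {i : Fin m} (hi : i ∈ F.S v.1) :
    (flip s hs v).sign i = s i * v.sign i := by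
  rw [Vertex.sign_of_mem (flip s hs v) hi, Vertex.sign_of_mem v hi]
  rfl

/-- Summation over the local solutions of one constraint. -/
theorem sum_vertex_ite {M : Type*} [AddCommMonoid M] (F : LinearBCS m p) (k : Fin p)
    (R : (F.S k → ℤˣ) → M) (hR : ∀ f, ∏ i, f i ≠ F.b k → R f = 0) :
    ∑ v : F.Vertex, (if v.1 = k then R (fun i => v.sign i) else 0) = ∑ f, R f := by
  have h1 : ∑ v : F.Vertex, (if v.1 = k then R (fun i => v.sign i) else 0) =
      ∑ l, ∑ f : F.LocalSolution l, if l = k then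
        R (fun i => Vertex.sign (F := F) ⟨l, f⟩ i) else 0 :=
    Fintype.sum_sigma _
  rw [h1, Finset.sum_eq_single k (fun l _ hl => by simp [hl]) (by simp)]
  have h2 : ∀ f : F.LocalSolution k, (fun i : F.S k => Vertex.sign (F := F) ⟨k, f⟩ i) = f.1 :=
    fun f => funext fun i => Vertex.sign_of_mem (F := F) ⟨k, f⟩ i.2
  simp only [if_true, h2]
  have h3 : ∑ f ∈ Finset.univ.filter (fun f : F.S k → ℤˣ => ∏ i, f i = F.b k), R f =
      ∑ f : F.LocalSolution k, R f.1 :=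
    Finset.sum_subtype _ (fun _ => Finset.mem_filter_univ _) R
  rw [← h3]
  exact Finset.sum_subset (Finset.subset_univ _) fun f _ hf => hR f fun h =>
    hf ((Finset.mem_filter_univ _).2 h)

section Entry

variable {K : Type*} [NormedAddCommGroup K] [InnerProductSpace ℂ K] [FiniteDimensional ℂ K]

/-- The quantum isomorphism from the graph of a system to that of its homogenisation, in terms of
the joint spectral projections `P l` of the operators of the `l`-th constraint. -/
noncomputable def entry (P : ∀ l, (F.S l → ℤˣ) → (K →ₗ[ℂ] K)) (v : F.Vertex)
    (w : F.homogenisation.Vertex) : K →ₗ[ℂ] K :=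
  if v.1 = w.1 then P v.1 (fun i => v.sign i * w.sign i) else 0

variable {Y : Fin m → (K →ₗ[ℂ] K)} {P : ∀ l, (F.S l → ℤˣ) → (K →ₗ[ℂ] K)}

theorem adjoint_entry (hP : ∀ l, IsResolution (fun i : F.S l => Y i) (P l)) (v : F.Vertex)
    (w : F.homogenisation.Vertex) : LinearMap.adjoint (entry P v w) = entry P v w := by
  unfold entry
  split_ifs
  · exact (hP _).selfAdjoint _
  · exact map_zero _

theorem mul_entry (hP : ∀ l, IsResolution (fun i : F.S l => Y i) (P l)) (v : F.Vertex)
    (w : F.homogenisation.Vertex) {i : Fin m} (hi : i ∈ F.S v.1) :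
    Y i * entry P v w = (((v.sign i * w.sign i : ℤˣ) : ℤ) : ℂ) • entry P v w := by
  unfold entry
  split_ifs
  · exact (hP v.1).mul_eq _ ⟨i, hi⟩
  · rw [mul_zero, smul_zero]

theorem entry_mul (hP : ∀ l, IsResolution (fun i : F.S l => Y i) (P l)) (v : F.Vertex)
    (w : F.homogenisation.Vertex) {i : Fin m} (hi : i ∈ F.S v.1) :
    entry P v w * Y i = (((v.sign i * w.sign i : ℤˣ) : ℤ) : ℂ) • entry P v w := by
  unfold entry
  split_ifs
  · have := (hP v.1).adjoint_mul (fun i => v.sign i * w.sign i) ⟨i, hi⟩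
    rwa [(hP v.1).selfAdjoint] at this
  · rw [zero_mul, smul_zero]

theorem fst_eq_of_entry_ne_zero {v : F.Vertex} {w : F.homogenisation.Vertex}
    (h : entry P v w ≠ 0) : v.1 = w.1 := by
  by_contra hvw
  exact h (if_neg hvw)

/-- A `Y i` placed between the two entries can be absorbed by either of them, and the two resulting
signs must agree. -/
theorem sign_eq_of_entry_mul_entry_ne_zero
    (hP : ∀ l, IsResolution (fun i : F.S l => Y i) (P l)) {v v' : F.Vertex}
    {w w' : F.homogenisation.Vertex} (h : entry P v w * entry P v' w' ≠ 0) {i : Fin m}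
    (hi : i ∈ F.S v.1) (hi' : i ∈ F.S v'.1) :
    v.sign i * w.sign i = v'.sign i * w'.sign i := by
  refine intUnit_eq_of_smul ?_ h
  rw [← smul_mul_assoc, ← entry_mul hP v w hi, mul_assoc, mul_entry hP v' w' hi', mul_smul_comm]

/-- Multiplication by a fixed local solution is a bijection between the solutions of a constraint
and those of its homogenised form, so row and column sums reduce to `∑ f, P l f = 1`. Orthogonality
and compatibility with adjacency follow by comparing signs on nonzero products of entries. -/
theorem isQuantumIso_entry (hP : ∀ l, IsResolution (fun i : F.S l => Y i) (P l))
    (hP0 : ∀ l f, ∏ i, f i ≠ F.b l → P l f = 0) :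
    IsQuantumIso F.graph F.homogenisation.graph (entry P) := by
  have hleft : ∀ w, ∑ v, entry P v w = 1 := fun w => by
    have h1 : ∀ v : F.Vertex, entry P v w = if v.1 = w.1 then
        P w.1 (fun i => v.sign i * w.sign i) else 0 := fun v => by
      unfold entry
      split_ifs with h
      · rw [h]
      · rfl
    simp only [h1]
    have h2 : ∏ i : F.S w.1, w.sign i = 1 := w.prod_sign
    refine (sum_vertex_ite F w.1 (fun f => P w.1 fun i => f i * w.sign i) fun f hf =>
      hP0 _ _ ?_).trans ?_
    · rwa [Finset.prod_mul_distrib, h2, mul_one]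
    · exact (Equiv.sum_comp (Equiv.mulRight fun i : F.S w.1 => w.sign i) (P w.1)).trans
        (hP w.1).sum_eq
  have hright : ∀ v, ∑ w, entry P v w = 1 := fun v => by
    have h1 : ∀ w : F.homogenisation.Vertex, entry P v w = if w.1 = v.1 then
        P v.1 (fun i => v.sign i * w.sign i) else 0 := fun w => by
      unfold entry
      simp only [eq_comm]
    simp only [h1]
    refine (sum_vertex_ite F.homogenisation v.1 (fun f => P v.1 fun i => v.sign i * f i)
      fun f hf => hP0 _ _ ?_).trans ?_
    · intro h
      refine hf (mul_left_cancel (a := F.b v.1) ?_)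
      rw [← v.prod_sign]
      exact (Finset.prod_mul_distrib.symm.trans (h.trans v.prod_sign.symm)).trans (mul_one _).symm
    · exact (Equiv.sum_comp (Equiv.mulLeft fun i : F.S v.1 => v.sign i) (P v.1)).trans
        (hP v.1).sum_eq
  refine ⟨adjoint_entry hP, fun v v' w hv => ?_, hleft, hright, fun v w => ?_⟩
  -- A nonzero product forces a common constraint and, after cancelling the signs of `w`, equal
  -- signs of `v` and `v'` on it.
  · by_contra h
    have h1 := fst_eq_of_entry_ne_zero (left_ne_zero_of_mul h)
    have h2 := fst_eq_of_entry_ne_zero (right_ne_zero_of_mul h)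
    have h12 := h1.trans h2.symm
    obtain ⟨i, hi, hs⟩ := Vertex.exists_sign_ne hv h12
    exact hs (mul_right_cancel
      (sign_eq_of_entry_mul_entry_ne_zero hP h hi (h12 ▸ hi)))
  -- On a nonzero product the signs satisfy `v * w' = v' * w` at shared variables, so the two
  -- adjacency entries coincide. Inserting a column sum and then removing a row sum gives the
  -- intertwining relation.
  · have h1 : ∀ w' v', adjEntry F.homogenisation.graph w w' • (entry P v w' * entry P v' w) =
        adjEntry F.graph v v' • (entry P v w' * entry P v' w) := fun w' v' => by
      by_cases h : entry P v w' * entry P v' w = 0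
      · rw [h, smul_zero, smul_zero]
      · have e1 : v.1 = w'.1 := fst_eq_of_entry_ne_zero (left_ne_zero_of_mul h)
        have e2 : v'.1 = w.1 := fst_eq_of_entry_ne_zero (right_ne_zero_of_mul h)
        congr 1
        have e3 : ∀ i ∈ F.S v.1, i ∈ F.S v'.1 → (w.sign i ≠ w'.sign i ↔ v.sign i ≠ v'.sign i) :=
          fun i hi hi' => by
            have := sign_eq_of_entry_mul_entry_ne_zero hP h hi hi'
            refine not_congr ⟨fun e => ?_, fun e => ?_⟩
            · rw [e] at this; exact mul_right_cancel this
            · rw [e] at this; exact (mul_left_cancel this).symm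
        have e4 : (w = w' ∨ F.homogenisation.graph.Adj w w') ↔ (v = v' ∨ F.graph.Adj v v') := by
          rw [eq_or_adj_iff, eq_or_adj_iff]
          refine or_congr ?_ (exists_congr fun i => ?_)
          · rw [← e1, ← e2]; exact eq_comm
          · change (i ∈ F.S w.1 ∧ i ∈ F.S w'.1 ∧ _) ↔ _
            rw [← e1, ← e2]
            constructor
            · rintro ⟨a, b, c⟩; exact ⟨b, a, (e3 i b a).1 c⟩
            · rintro ⟨a, b, c⟩; exact ⟨b, a, (e3 i a b).2 c⟩
        unfold adjEntry
        by_cases h' : v = v' ∨ F.graph.Adj v v'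
        · rw [if_pos h', if_pos (e4.2 h')]
        · rw [if_neg h', if_neg (h' ∘ e4.1)]
    calc ∑ w', adjEntry F.homogenisation.graph w w' • entry P v w'
        = ∑ w', ∑ v', adjEntry F.homogenisation.graph w w' •
            (entry P v w' * entry P v' w) := by
          refine Finset.sum_congr rfl fun w' _ => ?_
          rw [← Finset.smul_sum, ← Finset.mul_sum, hleft, mul_one]
      _ = ∑ v', ∑ w', adjEntry F.graph v v' • (entry P v w' * entry P v' w) := by
          rw [Finset.sum_comm]
          simp only [h1]
      _ = _ := by
          refine Finset.sum_congr rfl fun v' _ => ?_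
          rw [← Finset.smul_sum, ← Finset.sum_mul, hright, one_mul]

/-- Flipping `w` by `s` multiplies the index of the spectral projection by `s`, which is the effect
of conjugation by `u`. -/
theorem entry_flip (hP : ∀ l, IsResolution (fun i : F.S l => Y i) (P l)) {u : K →ₗ[ℂ] K}
    (hu : LinearMap.adjoint u * u = 1) (hu' : u * LinearMap.adjoint u = 1) (s : Fin m → ℤˣ)
    (hs : ∀ l, ∏ i ∈ F.S l, s i = 1)
    (hsY : ∀ i, u * Y i * LinearMap.adjoint u = ((s i : ℤ) : ℂ) • Y i) (v : F.Vertex)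
    (w : F.homogenisation.Vertex) :
    entry P v (flip s hs w) = u * entry P v w * LinearMap.adjoint u := by
  unfold entry
  rw [flip_fst]
  split_ifs with h
  · rw [← (hP v.1).conj hu hu' (fun i => s i) (fun i => hsY i)]
    congr 1
    funext i
    rw [flip_sign s hs w (h ▸ i.2), Pi.mul_apply, mul_left_comm]
  · rw [mul_zero, zero_mul]

end Entry

/-- The signs by which a unitary transforms the operators of a quantum solution solve the
homogenisation. -/
theorem IsQuantumSolution.prod_eq_one {H : Type*} [NormedAddCommGroup H] [InnerProductSpace ℂ H]
    [FiniteDimensional ℂ H] {X : Fin m → (H →ₗ[ℂ] H)} (hX : F.IsQuantumSolution X)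
    (hH : (1 : H →ₗ[ℂ] H) ≠ 0) {u : H →ₗ[ℂ] H}
    (hu : LinearMap.adjoint u * u = 1) (hu' : u * LinearMap.adjoint u = 1) (s : Fin m → ℤˣ)
    (hs : ∀ i, u * X i * LinearMap.adjoint u = ((s i : ℤ) : ℂ) • X i) (l : Fin p) :
    ∏ i ∈ F.S l, s i = 1 := by
  obtain ⟨P, hP, hP0⟩ := exists_isResolution hX
    (fun i => mul_self_of_eigenvalue (hX.selfAdjoint i) (hX.eigenvalue i)) l
  obtain ⟨f, hf⟩ : ∃ f, P f ≠ 0 := by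
    by_contra! h
    exact hH (by rw [← hP.sum_eq]; exact Finset.sum_eq_zero fun f _ => h f)
  have h1 := hP.conj hu hu' (fun i => s i) (fun i => hs i) f
  have h2 : P ((fun i : F.S l => s i) * f) ≠ 0 := fun h0 => hf <| by
    calc P f = LinearMap.adjoint u * u * P f * (LinearMap.adjoint u * u) := by
          rw [hu, one_mul, mul_one]
      _ = LinearMap.adjoint u * (u * P f * LinearMap.adjoint u) * u := by simp only [mul_assoc]
      _ = 0 := by rw [← h1, h0, mul_zero, zero_mul]
  -- Both `f` and `s * f` carry nonzero projections, hence both solve the constraint, and the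
  -- quotient `s` solves the homogenised one.
  have h3 : ∏ i, f i = F.b l := not_not.1 fun h => hf (hP0 f h)
  have h4 : ∏ i, ((fun i : F.S l => s i) * f) i = F.b l := not_not.1 fun h => h2 (hP0 _ h)
  simp only [Pi.mul_apply, Finset.prod_mul_distrib, h3] at h4
  rw [← Finset.prod_coe_sort]
  exact mul_eq_right.1 h4

end LinearBCS

/-! ### The action of the group and the isomorphism -/

theorem mainTheorem12 {m p : ℕ} (F : LinearBCS m p) (hF : ∀ i, ∃ l, i ∈ F.S l)
    {H : Type u} [NormedAddCommGroup H] [InnerProductSpace ℂ H] [FiniteDimensional ℂ H]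
    (X : Fin m → (H →ₗ[ℂ] H)) (hX : F.IsQuantumSolution X)
    (hirr : ∀ A : H →ₗ[ℂ] H, (∀ i, A * X i = X i * A) → ∃ c : ℂ, A = c • (1 : H →ₗ[ℂ] H))
    {L : Type*} [Group L] [Fintype L] (ψ : L → L → Circle) (hψ : IsCentralType ψ)
    (U : L → (H →ₗ[ℂ] H)) (hU : IsNiceUEB ψ U)
    (hconj : ∀ a i, ∃ s : ℤˣ, LinearMap.adjoint (U a) * X i * U a = ((s : ℤ) : ℂ) • X i) :
    ∃ φ : L →* (F.homogenisation.graph ≃g F.homogenisation.graph), Function.Injective φ ∧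
      ∀ (K : Type u) [NormedAddCommGroup K] [InnerProductSpace ℂ K] [FiniteDimensional ℂ K]
        (W : L → (K →ₗ[ℂ] K)) (hW : IsNiceUEB ψ W),
        Nonempty (QuantumGraph.Iso (QuantumGraph.ofSimpleGraph F.graph)
          (inducedGraph φ W hW)) := by
  have hH : (1 : H →ₗ[ℂ] H) ≠ 0 := fun h => hU.finrank_ne_zero (by
    rw [← LinearMap.trace_one, h, map_zero])
  have hsq : ∀ i, X i * X i = 1 := fun i =>
    mul_self_of_eigenvalue (hX.selfAdjoint i) (hX.eigenvalue i)
  have hX0 : ∀ i, X i ≠ 0 := fun i h => hH (by rw [← hsq i, h, mul_zero])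
  choose s hs using hconj
  -- The two directions of conjugation give the same sign, as signs are their own inverses.
  have hs' : ∀ a i, U a * X i * LinearMap.adjoint (U a) = ((s a i : ℤ) : ℂ) • X i :=
    fun a i => by
      have h : X i = ((s a i : ℤ) : ℂ) • (U a * X i * LinearMap.adjoint (U a)) := by
        calc X i = U a * LinearMap.adjoint (U a) * X i * (U a * LinearMap.adjoint (U a)) := by
              rw [(hU.unitary a).2, one_mul, mul_one]
          _ = U a * (LinearMap.adjoint (U a) * X i * U a) * LinearMap.adjoint (U a) := by
              simp only [mul_assoc]
          _ = _ := by rw [hs, mul_smul_comm, smul_mul_assoc]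
      conv_rhs => rw [h, smul_smul, intUnit_cast_mul_self, one_smul]
  have hmul : ∀ a b i, s (a * b) i = s a i * s b i := fun a b i => by
    refine intUnit_eq_of_smul ?_ (hX0 i)
    rw [← hs', hU.conj_mul, hs', mul_smul_comm, smul_mul_assoc, hs', smul_smul, Units.val_mul,
      Int.cast_mul, mul_comm]
  have hprod : ∀ a l, ∏ i ∈ F.S l, s a i = 1 := fun a =>
    hX.prod_eq_one hH (hU.unitary a).1 (hU.unitary a).2 (s a) (hs' a)
  let φ : L →* (F.homogenisation.graph ≃g F.homogenisation.graph) :=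
    MonoidHom.mk' (fun a => LinearBCS.flip (s a) (hprod a)) fun a b => RelIso.ext fun v =>
      Sigma.ext rfl (heq_of_eq (Subtype.ext (funext fun i => by
        change s (a * b) i * v.2.1 i = s a i * (s b i * v.2.1 i)
        rw [hmul, mul_assoc])))
  refine ⟨φ, (injective_iff_map_eq_one φ).2 fun a ha => ?_, fun K _ _ _ W hW => ?_⟩
  · have hsa : ∀ i, s a i = 1 := fun i => by
      obtain ⟨l, hl⟩ := hF i
      -- The constant assignment `1` solves every homogenised constraint; its image under `a`
      -- displays `s a i`.
      let v : F.homogenisation.Vertex := ⟨l, ⟨fun _ => 1, Finset.prod_const_one⟩⟩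
      have h1 := LinearBCS.flip_sign (s a) (hprod a) v hl
      have h2 : LinearBCS.flip (s a) (hprod a) v = v := congrArg (fun f => f v) ha
      rw [h2] at h1
      exact (mul_eq_right.1 h1.symm)
    obtain ⟨c, hc⟩ := hirr (U a) fun i => by
      have h := hs' a i
      rw [hsa, Units.val_one, Int.cast_one, one_smul] at h
      conv_rhs => rw [← h, mul_assoc, (hU.unitary a).1, mul_one]
    -- For `a ≠ 1` the scalar `U a = c • 1` is trace orthogonal to the phase `U 1`, so `c = 0`,
    -- which contradicts unitarity.
    by_contra ha1
    have h := hU.trace_eq 1 a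
    rw [if_neg (Ne.symm ha1), hU.map_one, map_smulₛₗ, Module.End.one_eq_id,
      LinearMap.adjoint_id, hc, ← Module.End.one_eq_id, smul_mul_smul_comm, one_mul, map_smul,
      LinearMap.trace_one, smul_eq_mul] at h
    have hc0 : c = 0 := by
      rcases mul_eq_zero.1 h with h | h
      · exact (mul_eq_zero.1 h).resolve_left (by simp)
      · exact absurd h hU.finrank_ne_zero
    have h0 := (hU.unitary a).1
    rw [hc, hc0, zero_smul, mul_zero] at h0
    exact hH h0.symm
  · obtain ⟨T, hT, hTadj⟩ := hU.exists_algHom hW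
    have hY := hX.map T hTadj
    choose P hP hP0 using fun l => LinearBCS.exists_isResolution hY
      (fun i => by rw [← map_mul, hsq, map_one]) l
    refine (LinearBCS.isQuantumIso_entry (Y := fun i => T (X i)) hP hP0).nonempty_iso φ hW
      fun a v w => LinearBCS.entry_flip (Y := fun i => T (X i)) hP (hW.unitary a).1
        (hW.unitary a).2 (s a) (hprod a) (fun i => ?_) v w
    have h := congrArg T (hs' a i)
    rwa [map_mul, map_mul, hTadj, hT, map_smul] at h
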